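/- Let $R$ be an arbitrary associative ring with unit and let $\mathcal{B}$ be a class of right $R$-modules containing all injective right $R$-modules. Let $\mathcal{PGF}_{\mathcal{B}}(R)$ be the class of projectively coresolved Gorenstein $\mathcal{B}$-flat left $R$-modules, that is, of those left $R$-modules $M$ for which there is an exact complex $$P = \cdots \to P_1 \to P_0 \to P_{-1} \to \cdots$$ of projective left $R$-modules such that $M \simeq Z_0(P) = \operatorname{Ker}(P_0 \to P_{-1})$ and such that the complex of abelian groups $B \otimes_R P$ is exact for every $B \in \mathcal{B}$. Then: (1) $\mathcal{PGF}_{\mathcal{B}}(R)$ is resolving: it contains all projective left $R$-modules; for every short exact sequence $0 \to M_1 \to M_2 \to M_3 \to 0$ of left $R$-modules with $M_1, M_3 \in \mathcal{PGF}_{\mathcal{B}}(R)$ one has $M_2 \in \mathcal{PGF}_{\mathcal{B}}(R)$; and the kernel of every epimorphism between modules in $\mathcal{PGF}_{\mathcal{B}}(R)$ belongs to $\mathcal{PGF}_{\mathcal{B}}(R)$. (2) $\mathcal{PGF}_{\mathcal{B}}(R)$ is closed under transfinite extensions: let $\lambda > 0$ be an ordinal and let $(S_\alpha)_{\alpha <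 \lambda}$ be a direct system of left $R$-modules which is continuous (that is, $S_\beta$ is the direct limit of $(S_\alpha)_{\alpha < \beta}$ for every limit ordinal $\beta < \lambda$), such that $S_0 \in \mathcal{PGF}_{\mathcal{B}}(R)$ and such that, for every $\alpha$ with $\alpha + 1 < \lambda$, the map $S_\alpha \to S_{\alpha+1}$ is a monomorphism with cokernel in $\mathcal{PGF}_{\mathcal{B}}(R)$. Then every module isomorphic to $\varinjlim_{\alpha < \lambda} S_\alpha$ belongs to $\mathcal{PGF}_{\mathcal{B}}(R)$. -/

import Mathlib

open CategoryTheory CategoryTheory.Limits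
open scoped TensorProduct

universe u

namespace RelGorenstein

noncomputable section

section Tensor

variable {R : Type u} [Ring R]
variable (N : Type u) [AddCommGroup N] [Module Rᵐᵒᵖ N]
variable (X : Type u) [AddCommGroup X] [Module R X]

/-- The subgroup of `N ⊗_ℤ X` generated by the elements `(n r) ⊗ x - n ⊗ (r x)`, for a right
`R`-module `N` (a left module over `Rᵐᵒᵖ`, with `n r` written `op r • n`) and a left `R`-module
`X`, over a ring `R` that need not be commutative. -/
def balancedRelations : Submodule ℤ (N ⊗[ℤ] X) :=
  Submodule.span ℤ
    {t | ∃ (n : N) (r : R) (x : X), t = (MulOpposite.op r • n) ⊗ₜ[ℤ] x - n ⊗ₜ[ℤ] (r • x)}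

/-- The tensor product `N ⊗_R X` of a right `R`-module and a left `R`-module, an abelian group. -/
abbrev BalancedTensor : Type u := (N ⊗[ℤ] X) ⧸ balancedRelations (R := R) N X

variable {X} {Y Z : Type u} [AddCommGroup Y] [Module R Y] [AddCommGroup Z] [Module R Z]

/-- The homomorphism `N ⊗_R f : N ⊗_R X → N ⊗_R Y`, `n ⊗ x ↦ n ⊗ f x`. -/
def BalancedTensor.map (f : X →ₗ[R] Y) :
    BalancedTensor (R := R) N X →ₗ[ℤ] BalancedTensor (R := R) N Y :=
  Submodule.mapQ _ _ (LinearMap.lTensor N f.toAddMonoidHom.toIntLinearMap) (by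
    rw [balancedRelations, Submodule.span_le]
    rintro _ ⟨n, r, x, rfl⟩
    refine Submodule.subset_span ⟨n, r, f x, ?_⟩
    change LinearMap.lTensor N f.toAddMonoidHom.toIntLinearMap _ = _
    rw [map_sub]
    change _ ⊗ₜ[ℤ] f x - n ⊗ₜ[ℤ] f (r • x) = _
    rw [f.map_smul]
    rfl)

theorem BalancedTensor.map_id :
    BalancedTensor.map (R := R) N (LinearMap.id : X →ₗ[R] X) = LinearMap.id := by
  refine Submodule.linearMap_qext _ (TensorProduct.ext' fun n x => ?_)
  rfl

theorem BalancedTensor.map_comp (g : Y →ₗ[R] Z) (f : X →ₗ[R] Y) :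
    BalancedTensor.map (R := R) N (g ∘ₗ f) =
      BalancedTensor.map (R := R) N g ∘ₗ BalancedTensor.map (R := R) N f := by
  refine Submodule.linearMap_qext _ (TensorProduct.ext' fun n x => ?_)
  rfl

theorem BalancedTensor.map_add (f g : X →ₗ[R] Y) :
    BalancedTensor.map (R := R) N (f + g) =
      BalancedTensor.map (R := R) N f + BalancedTensor.map (R := R) N g := by
  refine Submodule.linearMap_qext _ (TensorProduct.ext' fun n x => ?_)
  exact congrArg (Submodule.Quotient.mk) (TensorProduct.tmul_add n (f x) (g x))

end Tensor

variable {R : Type u} [Ring R]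

/-- The functor `N ⊗_R -` from left `R`-modules to abelian groups, for a right `R`-module `N`. -/
def tensorFunctor (N : ModuleCat.{u} Rᵐᵒᵖ) : ModuleCat.{u} R ⥤ ModuleCat.{u} ℤ where
  obj X := ModuleCat.of ℤ (BalancedTensor (R := R) N X)
  map f := ModuleCat.ofHom (BalancedTensor.map (R := R) N f.hom)
  map_id X := by
    rw [ModuleCat.hom_id, BalancedTensor.map_id]
    rfl
  map_comp f g := by
    rw [ModuleCat.hom_comp, BalancedTensor.map_comp]
    rfl

instance (N : ModuleCat.{u} Rᵐᵒᵖ) : (tensorFunctor (R := R) N).Additive where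
  map_add {X Y f g} := by
    change ModuleCat.ofHom (BalancedTensor.map (R := R) N (f + g).hom) = _
    rw [ModuleCat.hom_add, BalancedTensor.map_add]
    rfl

/-- A complex `P` of left `R`-modules (indexed by `ℤ`, with differentials of degree `-1`) is
`(𝓑 ⊗_R -)`-acyclic if the complex of abelian groups `N ⊗_R P` is exact for every `N ∈ 𝓑`. -/
def IsTensorAcyclic (B : ObjectProperty (ModuleCat.{u} Rᵐᵒᵖ))
    (P : ChainComplex (ModuleCat.{u} R) ℤ) : Prop :=
  ∀ N : ModuleCat.{u} Rᵐᵒᵖ, B N →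
    (((tensorFunctor (R := R) N).mapHomologicalComplex (ComplexShape.down ℤ)).obj P).Acyclic

/-- The class of projectively coresolved Gorenstein `𝓑`-flat modules: the modules (isomorphic to)
`Z_0(P) = Ker (P_0 → P_{-1})` for some exact and `(𝓑 ⊗_R -)`-acyclic complex `P` of projective
left `R`-modules. -/
def PGF (B : ObjectProperty (ModuleCat.{u} Rᵐᵒᵖ)) : ObjectProperty (ModuleCat.{u} R) := fun M =>
  ∃ P : ChainComplex (ModuleCat.{u} R) ℤ,
    (∀ m : ℤ, Projective (P.X m)) ∧ P.Acyclic ∧ IsTensorAcyclic B P ∧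
      Nonempty (M ≅ P.cycles 0)

/-- A class of modules is resolving if it contains the projective modules and is closed under
extensions and under kernels of epimorphisms between its members. -/
structure IsResolving (C : ObjectProperty (ModuleCat.{u} R)) : Prop where
  projective_mem : ∀ M : ModuleCat.{u} R, Projective M → C M
  extension_mem : ∀ S : ShortComplex (ModuleCat.{u} R), S.ShortExact → C S.X₁ → C S.X₃ → C S.X₂
  kernel_mem : ∀ (X Y : ModuleCat.{u} R) (f : X ⟶ Y), Epi f → C X → C Y → C (kernel f)

/-- `M` is a transfinite extension of the class `C`: it is the colimit of a system
`(S_α)_{α < λ}`, `λ > 0` an ordinal (here: a nonempty well-ordered type `J`), which is continuous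
(`S_β` is the colimit of the `S_α` with `α < β`, for every limit ordinal `β < λ`), with `S_0 ∈ C`,
and such that for every `α + 1 < λ` (that is, for every `α` that is not the greatest element of
`J`) the morphism `S_α → S_{α + 1}` is a monomorphism with cokernel in `C`. -/
def IsTransfiniteExtension (C : ObjectProperty (ModuleCat.{u} R)) (M : ModuleCat.{u} R) : Prop :=
  ∃ (J : Type u) (_ : LinearOrder J) (_ : OrderBot J) (_ : SuccOrder J) (_ : WellFoundedLT J)
    (S : J ⥤ ModuleCat.{u} R) (ι : S ⟶ (Functor.const J).obj M),
    Nonempty (IsColimit (Cocone.mk M ι)) ∧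
    S.IsWellOrderContinuous ∧
    C (S.obj ⊥) ∧
    ∀ α : J, ¬ IsMax α →
      Mono (S.map (homOfLE (Order.le_succ α))) ∧
        C (cokernel (S.map (homOfLE (Order.le_succ α))))

/-- Every transfinite extension of the class belongs to the class. -/
def IsClosedUnderTransfiniteExtensions (C : ObjectProperty (ModuleCat.{u} R)) : Prop :=
  ∀ M : ModuleCat.{u} R, IsTransfiniteExtension C M → C M

end

end RelGorenstein

/-! `PGF B` is the largest class in which every member M has short exact sequences 0 → K → P → M → 0
and 0 → M → P' → K' → 0 with P, P' projective and K, K' in the class, both exact after tensoring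
with `B`. Such sequences splice to a complex as in the definition, and the cycles of such a complex
form a class of this kind (`IsStableClass.le_PGF`, `isStableClass_PGF`). Every closure property thus
reduces to constructing two sequences.

For a module filtered by members of `PGF B`, the left sequence is a transfinite horseshoe lemma
(`LayeredFiltration.exists_left`). The right one needs the embeddings of the layers in projectives
to extend to the whole module, hence Ext¹(M, F) = 0 for M in `PGF B` and F projective
(`PGF.exists_extension`). So filtered modules lie in `PGF B` (`isFilteredBy_PGF_le`), which covers
extensions and transfinite extensions. For an epimorphism X → Y, adding a projective summand to the
kernel gives an extension of members of `PGF B`; the summand is then removed (`PGF_of_prod`).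

The vanishing of Ext is the deep point (`IsSummandDifferential.exists_primitive`) and the only use
of the injectives in `B`. Since products of injectives are injective, cycles supported in a finite
set of basis vectors bound inside a finite set, uniformly in the coefficients (`exists_boundsIn`).
The character module of a projective F is injective, so by duality cocycles with values in F have
primitives on finite sets (`BoundsIn.exists_factor`). A Mittag-Leffler argument glues these along
countable enlargements, and Zorn's lemma reaches the whole complex. -/

namespace RelGorenstein

noncomputable section

variable {R : Type u} [Ring R]

/-! ### Tensor products over a noncommutative ring: right exactness and filtrations. -/

section TensorLemmas

variable (N : Type u) [AddCommGroup N] [Module Rᵐᵒᵖ N]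
variable {X Y Z : Type u} [AddCommGroup X] [Module R X] [AddCommGroup Y] [Module R Y]
  [AddCommGroup Z] [Module R Z]

/-- The class `n ⊗ x` in the tensor product over a noncommutative ring. -/
def BalancedTensor.tmul {N : Type u} [AddCommGroup N] [Module Rᵐᵒᵖ N] (n : N) (x : X) :
    BalancedTensor (R := R) N X :=
  Submodule.Quotient.mk (n ⊗ₜ[ℤ] x)

variable {N}

theorem BalancedTensor.smul_tmul (n : N) (r : R) (x : X) :
    (tmul (MulOpposite.op r • n) x : BalancedTensor (R := R) N X) = tmul n (r • x) := by
  refine (Submodule.Quotient.eq _).2 (Submodule.subset_span ⟨n, r, x, rfl⟩)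

theorem BalancedTensor.add_tmul (n n' : N) (x : X) :
    (tmul (n + n') x : BalancedTensor (R := R) N X) = tmul n x + tmul n' x :=
  congrArg Submodule.Quotient.mk (TensorProduct.add_tmul n n' x)

theorem BalancedTensor.tmul_add (n : N) (x x' : X) :
    (tmul n (x + x') : BalancedTensor (R := R) N X) = tmul n x + tmul n x' :=
  congrArg Submodule.Quotient.mk (TensorProduct.tmul_add n x x')

theorem BalancedTensor.tmul_zero (n : N) : (tmul n (0 : X) : BalancedTensor (R := R) N X) = 0 :=
  congrArg Submodule.Quotient.mk (TensorProduct.tmul_zero X n)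

theorem BalancedTensor.zero_tmul (x : X) : (tmul (0 : N) x : BalancedTensor (R := R) N X) = 0 :=
  congrArg Submodule.Quotient.mk (TensorProduct.zero_tmul N x)

@[elab_as_elim]
theorem BalancedTensor.induction {p : BalancedTensor (R := R) N X → Prop} (zero : p 0)
    (tmul : ∀ n x, p (tmul n x)) (add : ∀ y z, p y → p z → p (y + z))
    (x : BalancedTensor (R := R) N X) : p x := by
  obtain ⟨t, rfl⟩ := Submodule.Quotient.mk_surjective _ x
  induction t with
  | zero => exact zero
  | tmul n x => exact tmul n x
  | add y z hy hz => exact add _ _ hy hz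

variable (N)

@[simp]
theorem BalancedTensor.map_tmul (f : X →ₗ[R] Y) (n : N) (x : X) :
    BalancedTensor.map (R := R) N f (tmul n x) = tmul n (f x) :=
  rfl

theorem BalancedTensor.map_map (g : Y →ₗ[R] Z) (f : X →ₗ[R] Y) (x : BalancedTensor (R := R) N X) :
    BalancedTensor.map (R := R) N g (BalancedTensor.map (R := R) N f x) =
      BalancedTensor.map (R := R) N (g ∘ₗ f) x := by
  rw [BalancedTensor.map_comp]
  rfl

theorem BalancedTensor.map_zero_left (x : BalancedTensor (R := R) N X) :
    BalancedTensor.map (R := R) N (0 : X →ₗ[R] Y) x = 0 := by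
  induction x using BalancedTensor.induction with
  | zero => exact map_zero _
  | tmul n x => exact BalancedTensor.tmul_zero n
  | add y z hy hz => rw [_root_.map_add, hy, hz, add_zero]

theorem BalancedTensor.map_surjective (f : X →ₗ[R] Y) (hf : Function.Surjective f) :
    Function.Surjective (BalancedTensor.map (R := R) N f) := by
  intro y
  induction y using BalancedTensor.induction with
  | zero => exact ⟨0, map_zero _⟩
  | tmul n y =>
    obtain ⟨x, rfl⟩ := hf y
    exact ⟨tmul n x, rfl⟩
  | add y z hy hz =>
    obtain ⟨a, rfl⟩ := hy
    obtain ⟨b, rfl⟩ := hz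
    exact ⟨a + b, _root_.map_add _ _ _⟩

/-- The balancing relations of `Z` lift along the surjection `g`. An element killed modulo relations
can therefore be corrected by relations of `Y` so that right exactness over ℤ applies. -/
theorem BalancedTensor.map_exact (f : X →ₗ[R] Y) (g : Y →ₗ[R] Z) (hg : Function.Surjective g)
    (h : Function.Exact f g) :
    Function.Exact (BalancedTensor.map (R := R) N f) (BalancedTensor.map (R := R) N g) := by
  intro y
  constructor
  · intro hy
    obtain ⟨t, rfl⟩ := Submodule.Quotient.mk_surjective _ y
    have hrel : ∀ w ∈ balancedRelations (R := R) N Z, ∃ v ∈ balancedRelations (R := R) N Y,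
        LinearMap.lTensor N g.toAddMonoidHom.toIntLinearMap v = w := by
      intro w hw
      induction hw using Submodule.span_induction with
      | mem w hw =>
        obtain ⟨n, r, z, rfl⟩ := hw
        obtain ⟨y, rfl⟩ := hg z
        refine ⟨_, Submodule.subset_span ⟨n, r, y, rfl⟩, ?_⟩
        rw [map_sub]
        change _ ⊗ₜ[ℤ] g y - n ⊗ₜ[ℤ] g (r • y) = _
        rw [g.map_smul]
        rfl
      | zero => exact ⟨0, Submodule.zero_mem _, map_zero _⟩
      | add x y _ _ hx hy =>
        obtain ⟨a, ha, rfl⟩ := hx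
        obtain ⟨b, hb, rfl⟩ := hy
        exact ⟨a + b, Submodule.add_mem _ ha hb, _root_.map_add _ _ _⟩
      | smul c x _ hx =>
        obtain ⟨a, ha, rfl⟩ := hx
        exact ⟨c • a, Submodule.smul_mem _ _ ha, map_smul _ _ _⟩
    have hy' : LinearMap.lTensor N g.toAddMonoidHom.toIntLinearMap t ∈
        balancedRelations (R := R) N Z := (Submodule.Quotient.mk_eq_zero _).1 hy
    obtain ⟨v, hv, hv'⟩ := hrel _ hy'
    have hex : Function.Exact (LinearMap.lTensor N f.toAddMonoidHom.toIntLinearMap)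
        (LinearMap.lTensor N g.toAddMonoidHom.toIntLinearMap) :=
      lTensor_exact N (f := f.toAddMonoidHom.toIntLinearMap)
        (g := g.toAddMonoidHom.toIntLinearMap) h hg
    obtain ⟨s, hs⟩ := (hex (t - v)).1 (by rw [map_sub, hv', sub_self])
    refine ⟨Submodule.Quotient.mk s, ?_⟩
    change Submodule.Quotient.mk (LinearMap.lTensor N f.toAddMonoidHom.toIntLinearMap s) = _
    rw [hs]
    exact (Submodule.Quotient.eq _).2 (by simpa using hv)
  · rintro ⟨x, rfl⟩
    rw [BalancedTensor.map_map, h.linearMap_comp_eq_zero, BalancedTensor.map_zero_left]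

/-- An element of a tensor product with a directed union comes from one of the pieces. -/
theorem BalancedTensor.exists_of_mem_directed {J : Type u} [LinearOrder J] (p : J → Prop)
    (F : J → Submodule R Y) (hF : Monotone F) (f : X →ₗ[R] Y)
    (h : ∀ x, f x = 0 ∨ ∃ j, p j ∧ f x ∈ F j) (x : BalancedTensor (R := R) N X) :
    BalancedTensor.map (R := R) N f x = 0 ∨ ∃ j, p j ∧ ∃ y : BalancedTensor (R := R) N (F j),
      BalancedTensor.map (R := R) N (F j).subtype y = BalancedTensor.map (R := R) N f x := by
  induction x using BalancedTensor.induction with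
  | zero => exact Or.inl (map_zero _)
  | tmul n x =>
    obtain h | ⟨j, hj, hx⟩ := h x
    · left
      rw [BalancedTensor.map_tmul, h, BalancedTensor.tmul_zero]
    · exact Or.inr ⟨j, hj, tmul n ⟨f x, hx⟩, rfl⟩
  | add y z hy hz =>
    rw [_root_.map_add]
    obtain hy | ⟨j, hj, y', hy⟩ := hy
    · rw [hy, zero_add]
      exact hz
    obtain hz | ⟨k, hk, z', hz⟩ := hz
    · rw [hz, add_zero]
      exact Or.inr ⟨j, hj, y', hy⟩
    right
    have key : ∀ {i j : J} (hij : i ≤ j) (w : BalancedTensor (R := R) N (F i)),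
        BalancedTensor.map (R := R) N (F j).subtype
          (BalancedTensor.map (R := R) N (Submodule.inclusion (hF hij)) w) =
        BalancedTensor.map (R := R) N (F i).subtype w := by
      intro i j hij w
      rw [BalancedTensor.map_map]
      rfl
    rcases le_total j k with hjk | hjk
    · exact ⟨k, hk, _ + z', by rw [_root_.map_add, key hjk y', hy, hz]⟩
    · exact ⟨j, hj, y' + _, by rw [_root_.map_add, key hjk z', hy, hz]⟩

/-- A criterion for a homomorphism from a filtered module to stay injective after tensoring. -/
theorem BalancedTensor.map_injective_of_filtration {J : Type u} [LinearOrder J] [WellFoundedLT J]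
    (F : J → Submodule R X) (hF : Monotone F) (hex : ∀ x : X, x = 0 ∨ ∃ j, x ∈ F j)
    (f : X →ₗ[R] Y) {A Q : J → Type u} [∀ j, AddCommGroup (A j)] [∀ j, Module R (A j)]
    [∀ j, AddCommGroup (Q j)] [∀ j, Module R (Q j)] (q : ∀ j, F j →ₗ[R] A j)
    (hq : ∀ j, Function.Surjective (q j))
    (hker : ∀ j x, q j x = 0 → (x : X) = 0 ∨ ∃ i < j, (x : X) ∈ F i) (m : ∀ j, A j →ₗ[R] Q j)
    (hm : ∀ j, Function.Injective (BalancedTensor.map (R := R) N (m j))) (e : ∀ j, Y →ₗ[R] Q j)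
    (he : ∀ j (x : F j), e j (f x) = m j (q j x)) :
    Function.Injective (BalancedTensor.map (R := R) N f) := by
  -- Only the image in N ⊗ X is claimed to vanish, as N ⊗ F j → N ⊗ X need not be injective. Since
  -- `m j` stays injective, x comes from ker (q j), whose elements are zero or lie in earlier
  -- pieces. A tensor involves finitely many of them, so its image is zero or comes from a single F
  -- i with i < j.
  have main : ∀ j (x : BalancedTensor (R := R) N (F j)),
      BalancedTensor.map (R := R) N f (BalancedTensor.map (R := R) N (F j).subtype x) = 0 →
      BalancedTensor.map (R := R) N (F j).subtype x = 0 := by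
    intro j
    induction j using WellFoundedLT.induction with
    | _ j ih =>
      intro x hx
      have hqx : BalancedTensor.map (R := R) N (q j) x = 0 := by
        apply hm j
        have hcomp : m j ∘ₗ q j = e j ∘ₗ f ∘ₗ (F j).subtype :=
          LinearMap.ext fun y => (he j y).symm
        rw [BalancedTensor.map_map, hcomp, map_zero, ← BalancedTensor.map_map,
          ← BalancedTensor.map_map, hx, map_zero]
      obtain ⟨z, rfl⟩ := (BalancedTensor.map_exact N (LinearMap.ker (q j)).subtype (q j) (hq j)
        (LinearMap.exact_subtype_ker_map (q j)) x).1 hqx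
      rw [BalancedTensor.map_map N (F j).subtype] at hx ⊢
      obtain h | ⟨i, hi, y, hy⟩ := BalancedTensor.exists_of_mem_directed N (· < j) F hF
        ((F j).subtype ∘ₗ (LinearMap.ker (q j)).subtype) (fun x => hker j _ x.2) z
      · exact h
      · rw [← hy] at hx ⊢
        exact ih i hi y hx
  rw [injective_iff_map_eq_zero]
  intro x hx
  obtain h | ⟨i, -, y, hy⟩ := BalancedTensor.exists_of_mem_directed N (fun _ => True) F hF
    LinearMap.id (fun x => by simpa using hex x) x
  · simpa [BalancedTensor.map_id] using h
  · rw [BalancedTensor.map_id, LinearMap.id_apply] at hy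
    rw [← hy] at hx ⊢
    exact main i y hx

end TensorLemmas

/-! ### Character modules of projective modules are injective. -/

section RightDual

/-- The character module of a left `R`-module, as a right `R`-module. -/
def RightDual (F : Type u) [AddCommGroup F] : Type u := F →+ AddCircle (1 : ℚ)

variable (F : Type u) [AddCommGroup F]

instance : AddCommGroup (RightDual F) := inferInstanceAs (AddCommGroup (F →+ AddCircle (1 : ℚ)))

instance : FunLike (RightDual F) F (AddCircle (1 : ℚ)) :=
  inferInstanceAs (FunLike (F →+ AddCircle (1 : ℚ)) F (AddCircle (1 : ℚ)))

instance : AddMonoidHomClass (RightDual F) F (AddCircle (1 : ℚ)) :=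
  inferInstanceAs (AddMonoidHomClass (F →+ AddCircle (1 : ℚ)) F (AddCircle (1 : ℚ)))

variable {F} [Module R F]

@[ext]
theorem RightDual.ext {χ ψ : RightDual F} (h : ∀ x, χ x = ψ x) : χ = ψ :=
  DFunLike.ext _ _ h

@[simp]
theorem RightDual.add_apply (χ ψ : RightDual F) (x : F) : (χ + ψ) x = χ x + ψ x := rfl

@[simp]
theorem RightDual.zero_apply (x : F) : (0 : RightDual F) x = 0 := rfl

instance : Module Rᵐᵒᵖ (RightDual F) where
  smul r χ := AddMonoidHom.comp (χ : F →+ AddCircle (1 : ℚ))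
    (DistribSMul.toAddMonoidHom F r.unop)
  one_smul χ := RightDual.ext fun x => congrArg χ (one_smul R x)
  mul_smul r s χ := RightDual.ext fun x => congrArg χ (mul_smul s.unop r.unop x)
  smul_zero _ := rfl
  smul_add _ _ _ := rfl
  add_smul r s χ := RightDual.ext fun x =>
    (congrArg χ (add_smul r.unop s.unop x)).trans (map_add χ _ _)
  zero_smul χ := RightDual.ext fun x => (congrArg χ (zero_smul R x)).trans (map_zero χ)

@[simp]
theorem RightDual.smul_apply (r : Rᵐᵒᵖ) (χ : RightDual F) (x : F) : (r • χ) x = χ (r.unop • x) :=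
  rfl

theorem RightDual.exists_extension {X Y : Type u} [AddCommGroup X] [AddCommGroup Y] (f : X →+ Y)
    (hf : Function.Injective f) (φ : X →+ AddCircle (1 : ℚ)) :
    ∃ ψ : Y →+ AddCircle (1 : ℚ), ∀ x, ψ (f x) = φ x := by
  obtain ⟨ψ, hψ⟩ := CharacterModule.dual_surjective_of_injective f.toIntLinearMap hf φ
  exact ⟨ψ, fun x => DFunLike.congr_fun hψ x⟩

/-- Divisibility of ℚ/ℤ extends each character x ↦ φ x b to a character ψ b of `Y`, without regard
to scalars. A linear section of R^(F) → F writes a = Σ r_b b, and y ↦ (a ↦ Σ ψ b (y r_b)) is then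
linear over the ring and extends φ. -/
theorem RightDual.injective_of_projective [Module.Projective R F] :
    Module.Injective Rᵐᵒᵖ (RightDual F) where
  out X Y _ _ _ _ f hf φ := by
    obtain ⟨s, hs⟩ := Module.projective_def.1 ‹Module.Projective R F›
    have hx : ∀ b : F, ∃ ψ : Y →+ AddCircle (1 : ℚ), ∀ x, ψ (f x) = φ x b := fun b =>
      RightDual.exists_extension f.toAddMonoidHom hf
        { toFun := fun x => φ x b
          map_zero' := by simp
          map_add' := by simp }
    choose ψ hψ using hx
    let t (y : Y) : F →+ AddCircle (1 : ℚ) :=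
      (Finsupp.liftAddHom fun b => (ψ b).comp
        ((smulAddHom Rᵐᵒᵖ Y).flip y |>.comp MulOpposite.opAddEquiv.toAddMonoidHom)).comp
          s.toAddMonoidHom
    have ht : ∀ y a, t y a = (s a).sum fun b r => ψ b (MulOpposite.op r • y) := fun y a => rfl
    refine ⟨{ toFun := t, map_add' := fun y z => ?_, map_smul' := fun r y => ?_ }, fun x => ?_⟩
    · refine RightDual.ext fun a => ?_
      change t _ a = t _ a + t _ a
      simp only [ht, smul_add, map_add, Finsupp.sum_add]
    · refine RightDual.ext fun a => ?_
      change t _ a = t _ (r.unop • a)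
      rw [ht, ht, map_smul, Finsupp.sum_smul_index (by simp)]
      refine Finsupp.sum_congr fun b _ => ?_
      rw [smul_smul]
      rfl
    · refine RightDual.ext fun a => ?_
      change t _ a = _
      rw [ht]
      have h1 : ∀ b r, ψ b (MulOpposite.op r • f x) = φ x (r • b) := fun b r => by
        rw [← map_smul, hψ, map_smul]
        rfl
      simp only [h1]
      rw [← map_finsuppSum]
      exact congrArg (φ x) (hs a)

end RightDual

/-! ### Coordinates on tensor products with free modules, supports, and the pairing with cochains.
-/

section Coordinates

variable {ι : Type u} (N : Type u) [AddCommGroup N] [Module Rᵐᵒᵖ N]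

/-- The homomorphism `R → N`, `r ↦ n r`. -/
def scalarHom {N : Type u} [AddCommGroup N] [Module Rᵐᵒᵖ N] (n : N) : R →+ N :=
  ((smulAddHom Rᵐᵒᵖ N).flip n).comp (MulOpposite.opAddEquiv (α := R)).toAddMonoidHom

variable {N} in
@[simp]
theorem scalarHom_apply (n : N) (r : R) : scalarHom n r = MulOpposite.op r • n := rfl

/-- The coordinate isomorphism from finitely supported functions to `N ⊗ R^(ι)`, in one
direction. -/
def ofCoords : (ι →₀ N) →+ BalancedTensor (R := R) N (ι →₀ R) :=
  Finsupp.liftAddHom fun j =>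
    { toFun := fun n => BalancedTensor.tmul n (Finsupp.single j 1)
      map_zero' := BalancedTensor.zero_tmul _
      map_add' := fun n n' => BalancedTensor.add_tmul n n' _ }

variable {N} in
@[simp]
theorem ofCoords_single (j : ι) (n : N) :
    ofCoords (R := R) N (Finsupp.single j n) = BalancedTensor.tmul n (Finsupp.single j 1) := by
  exact Finsupp.liftAddHom_apply_single _ _ _

/-- The biadditive map `(n, x) ↦ n x` underlying the coordinates on `N ⊗ R^(ι)`. -/
def coordsBilin : N →+ (ι →₀ R) →+ (ι →₀ N) where
  toFun n := Finsupp.mapRange.addMonoidHom (scalarHom n)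
  map_zero' := by ext; simp
  map_add' n n' := by ext; simp

/-- The coordinates of an element of `N ⊗ R^(ι)`. -/
def toCoords : BalancedTensor (R := R) N (ι →₀ R) →ₗ[ℤ] (ι →₀ N) :=
  Submodule.liftQ _ (TensorProduct.liftAddHom (coordsBilin N) (fun c n x => by
    rw [map_zsmul, map_zsmul, AddMonoidHom.zsmul_apply])).toIntLinearMap (by
    rw [balancedRelations, Submodule.span_le]
    rintro _ ⟨n, r, x, rfl⟩
    refine LinearMap.mem_ker.2 ?_
    rw [map_sub]
    refine sub_eq_zero.2 (Finsupp.ext fun j => ?_)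
    change MulOpposite.op (x j) • MulOpposite.op r • n = MulOpposite.op (r • x j) • n
    rw [smul_smul]
    rfl)

variable {N}

@[simp]
theorem toCoords_tmul (n : N) (x : ι →₀ R) (j : ι) :
    toCoords N (BalancedTensor.tmul n x) j = MulOpposite.op (x j) • n := rfl

theorem ofCoords_toCoords (t : BalancedTensor (R := R) N (ι →₀ R)) :
    ofCoords (R := R) N (toCoords N t) = t := by
  induction t using BalancedTensor.induction with
  | zero => simp
  | add y z hy hz => rw [map_add, map_add, hy, hz]
  | tmul n x =>
    induction x using Finsupp.induction_linear with
    | zero => rw [BalancedTensor.tmul_zero, map_zero, map_zero]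
    | add y z hy hz => rw [BalancedTensor.tmul_add, map_add, map_add, hy, hz]
    | single j r =>
      have h : toCoords N (BalancedTensor.tmul n (Finsupp.single j r)) =
          Finsupp.single j (MulOpposite.op r • n) := by
        classical
        ext k
        rw [toCoords_tmul, Finsupp.single_apply, Finsupp.single_apply]
        split_ifs <;> simp
      rw [h, ofCoords_single, BalancedTensor.smul_tmul, Finsupp.smul_single, smul_eq_mul, mul_one]

variable (N) in
/-- The endomorphism `N ⊗ d` in coordinates, for an endomorphism `d` of a free module. -/
def coordMap (d : (ι →₀ R) →ₗ[R] (ι →₀ R)) : (ι →₀ N) →+ (ι →₀ N) :=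
  (toCoords (R := R) N).toAddMonoidHom.comp
    ((BalancedTensor.map N d).toAddMonoidHom.comp (ofCoords (R := R) N))

variable (d e : (ι →₀ R) →ₗ[R] (ι →₀ R))

theorem coordMap_def (y : ι →₀ N) :
    coordMap N d y = toCoords N (BalancedTensor.map N d (ofCoords N y)) := rfl

theorem coordMap_coordMap (y : ι →₀ N) :
    coordMap N d (coordMap N e y) = coordMap N (d ∘ₗ e) y := by
  rw [coordMap_def, coordMap_def, coordMap_def, ofCoords_toCoords, BalancedTensor.map_map]

theorem coordMap_zero (y : ι →₀ N) : coordMap N (0 : (ι →₀ R) →ₗ[R] (ι →₀ R)) y = 0 := by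
  rw [coordMap_def, BalancedTensor.map_zero_left, map_zero]

theorem coordMap_single_apply (j k : ι) (n : N) :
    coordMap N d (Finsupp.single j n) k = MulOpposite.op (d (Finsupp.single j 1) k) • n := by
  rw [coordMap_def, ofCoords_single, BalancedTensor.map_tmul, toCoords_tmul]

theorem coordMap_apply (y : ι →₀ N) (k : ι) :
    coordMap N d y k = y.sum fun j n => MulOpposite.op (d (Finsupp.single j 1) k) • n := by
  induction y using Finsupp.induction_linear with
  | zero => simp
  | add y z hy hz =>
    rw [map_add, Finsupp.add_apply, hy, hz, Finsupp.sum_add_index'] <;> simp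
  | single j n => rw [coordMap_single_apply, Finsupp.sum_single_index (by simp)]

/-- The matrix of `d` acts on coefficients by scalars only. This naturality is needed for the
projections of a product of injective modules. -/
theorem coordMap_mapRange {N' : Type u} [AddCommGroup N'] [Module Rᵐᵒᵖ N'] (f : N →ₗ[Rᵐᵒᵖ] N')
    (y : ι →₀ N) :
    coordMap N' d (Finsupp.mapRange.addMonoidHom f.toAddMonoidHom y) =
      Finsupp.mapRange.addMonoidHom f.toAddMonoidHom (coordMap N d y) := by
  induction y using Finsupp.induction_linear with
  | zero => simp
  | add y z hy hz => simp only [map_add, hy, hz]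
  | single j n =>
    ext k
    simp [coordMap_single_apply]

/-- The finitely supported function `y` vanishes outside of `S`. -/
def SuppIn {A : Type u} [Zero A] (S : Set ι) (y : ι →₀ A) : Prop := ∀ j, j ∉ S → y j = 0

theorem SuppIn.add {A : Type u} [AddCommGroup A] {S : Set ι} {y z : ι →₀ A} (hy : SuppIn S y)
    (hz : SuppIn S z) : SuppIn S (y + z) := fun j hj => by
  rw [Finsupp.add_apply, hy j hj, hz j hj, add_zero]

theorem SuppIn.neg {A : Type u} [AddCommGroup A] {S : Set ι} {y : ι →₀ A} (hy : SuppIn S y) :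
    SuppIn S (-y) := fun j hj => by
  rw [Finsupp.neg_apply, hy j hj, neg_zero]

theorem SuppIn.mono {A : Type u} [Zero A] {S T : Set ι} {y : ι →₀ A} (hy : SuppIn S y)
    (h : S ⊆ T) : SuppIn T y := fun j hj => hy j fun hjS => hj (h hjS)

theorem SuppIn.mem {A : Type u} [Zero A] {S : Set ι} {y : ι →₀ A} (hy : SuppIn S y) {j : ι}
    (hj : j ∈ y.support) : j ∈ S :=
  by_contra fun h => Finsupp.mem_support_iff.1 hj (hy j h)

/-- The coordinate submodule of `S` is stable under `d`. -/
def IsStableSet (S : Set ι) : Prop := ∀ j ∈ S, SuppIn S (d (Finsupp.single j 1))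

variable {d e} in
theorem IsStableSet.coordMap {S : Set ι} (h : IsStableSet d S) {y : ι →₀ N} (hy : SuppIn S y) :
    SuppIn S (coordMap N d y) := fun k hk => by
  rw [coordMap_apply]
  refine Finset.sum_eq_zero fun j hj => ?_
  dsimp only
  rw [h j (hy.mem hj) k hk, MulOpposite.op_zero, zero_smul]

/-- Two linear maps that agree on the basis vectors in `S` agree on the span of these. -/
theorem SuppIn.map_eq {F : Type u} [AddCommGroup F] [Module R F] {S : Set ι} {x : ι →₀ R}
    (hx : SuppIn S x) {f g : (ι →₀ R) →ₗ[R] F}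
    (h : ∀ j ∈ S, f (Finsupp.single j 1) = g (Finsupp.single j 1)) : f x = g x := by
  have hs : ∀ f : (ι →₀ R) →ₗ[R] F, f x = x.sum fun j r => r • f (Finsupp.single j 1) := by
    intro f
    conv_lhs => rw [← Finsupp.sum_single x]
    rw [map_finsuppSum]
    refine Finsupp.sum_congr fun j _ => ?_
    rw [← map_smul, Finsupp.smul_single, smul_eq_mul, mul_one]
  rw [hs f, hs g]
  exact Finsupp.sum_congr fun j hj => by rw [h j (hx.mem hj)]

/-- The pairing between `F⁺ ⊗ R^(ι)` and `Hom(R^(ι), F)`. -/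
def dualPairing {F : Type u} [AddCommGroup F] [Module R F] (g : (ι →₀ R) →ₗ[R] F) :
    (ι →₀ RightDual F) →+ AddCircle (1 : ℚ) :=
  Finsupp.liftAddHom fun j =>
    { toFun := fun χ => χ (g (Finsupp.single j 1))
      map_zero' := rfl
      map_add' := fun _ _ => rfl }

theorem dualPairing_apply {F : Type u} [AddCommGroup F] [Module R F] (g : (ι →₀ R) →ₗ[R] F)
    (y : ι →₀ RightDual F) :
    dualPairing g y = y.sum fun j χ => χ (g (Finsupp.single j 1)) := rfl

/-- Moving scalars from a character to its argument turns the matrix of `d` on chains into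
precomposition with `d`. By this adjunction, bounds for cycles control cochains. -/
theorem dualPairing_coordMap {F : Type u} [AddCommGroup F] [Module R F] (g : (ι →₀ R) →ₗ[R] F)
    (y : ι →₀ RightDual F) :
    dualPairing g (coordMap (RightDual F) d y) = dualPairing (g ∘ₗ d) y := by
  induction y using Finsupp.induction_linear with
  | zero => simp
  | add y z hy hz => rw [map_add, map_add, map_add, hy, hz]
  | single j χ =>
    have h : coordMap (RightDual F) d (Finsupp.single j χ) =
        (d (Finsupp.single j 1)).mapRange (scalarHom χ) (map_zero _) := by
      ext k
      rw [coordMap_single_apply]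
      rfl
    rw [h, dualPairing_apply, dualPairing_apply, Finsupp.sum_mapRange_index (fun _ => rfl),
      Finsupp.sum_single_index rfl]
    simp only [scalarHom_apply, RightDual.smul_apply, MulOpposite.unop_op, LinearMap.comp_apply]
    rw [← map_finsuppSum]
    congr 1
    conv_rhs => rw [← Finsupp.sum_single (d (Finsupp.single j 1))]
    rw [map_finsuppSum]
    refine Finsupp.sum_congr fun k _ => ?_
    rw [← map_smul, Finsupp.smul_single, smul_eq_mul, mul_one]

theorem dualPairing_eq_zero {F : Type u} [AddCommGroup F] [Module R F] {g : (ι →₀ R) →ₗ[R] F}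
    {y : ι →₀ RightDual F} {S : Set ι} (hy : SuppIn S y)
    (hg : ∀ j ∈ S, g (Finsupp.single j 1) = 0) : dualPairing g y = 0 := by
  rw [dualPairing_apply]
  refine Finset.sum_eq_zero fun j hj => ?_
  dsimp only
  rw [hg j (hy.mem hj), map_zero]

end Coordinates

/-! ### Cocycles with values in projective modules are coboundaries. -/

section Cocycles

variable {ι : Type u}

/-- A differential `d` on a direct summand of a free module, the summand being the image of the
idempotent `e`. -/
structure IsSummandDifferential (d e : (ι →₀ R) →ₗ[R] (ι →₀ R)) : Prop where
  d_d : d ∘ₗ d = 0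
  e_e : e ∘ₗ e = e
  d_e : d ∘ₗ e = d
  e_d : e ∘ₗ d = d

/-- The basis vectors in `S` span a subcomplex that stays exact after tensoring with injective
right modules. -/
structure IsExactSet (d e : (ι →₀ R) →ₗ[R] (ι →₀ R)) (S : Set ι) : Prop where
  stable_d : IsStableSet d S
  stable_e : IsStableSet e S
  exact : ∀ (I : Type u) [AddCommGroup I] [Module Rᵐᵒᵖ I], Module.Injective Rᵐᵒᵖ I →
    ∀ y : ι →₀ I, SuppIn S y → coordMap I d y = 0 →
      ∃ w : ι →₀ I, SuppIn S w ∧ coordMap I e y = coordMap I d w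

/-- Cycles modulo `S` supported in `V` bound modulo `S` chains supported in `V'`, uniformly in the
injective coefficient module. -/
def BoundsIn (d e : (ι →₀ R) →ₗ[R] (ι →₀ R)) (S V V' : Set ι) : Prop :=
  ∀ (I : Type u) [AddCommGroup I] [Module Rᵐᵒᵖ I], Module.Injective Rᵐᵒᵖ I →
    ∀ y : ι →₀ I, SuppIn V y → SuppIn S (coordMap I d y) →
      ∃ w : ι →₀ I, SuppIn V' w ∧ SuppIn S (coordMap I e y - coordMap I d w)

variable {d e : (ι →₀ R) →ₗ[R] (ι →₀ R)} {S : Set ι}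

theorem BoundsIn.mono {V V' W : Set ι} (h : BoundsIn d e S V V') (hW : V' ⊆ W) :
    BoundsIn d e S V W := by
  intro I _ _ hI y hy hdy
  obtain ⟨w, hw, h⟩ := h I hI y hy hdy
  exact ⟨w, hw.mono hW, h⟩

/-- Duality: the vectors (k (d b_v))_v with k zero on `S` form a subgroup of F^V. If (g (e b_v))_v
were not in it, a character of F^V would separate them; its components form a chain y over the
character module of `F`, supported in `V` and a cycle modulo `S`. That module is injective, so e y =
d w modulo `S` with w supported in `V'`, and pairing with g yields ⟨g e, y⟩ = ⟨g d, w⟩ = 0, a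
contradiction. -/
theorem BoundsIn.exists_factor {F : Type u} [AddCommGroup F] [Module R F] [Module.Projective R F]
    {V : Finset ι} {V' : Set ι} (hV : BoundsIn d e S V V')
    (g : (ι →₀ R) →ₗ[R] F) (hgS : ∀ j ∈ S, g (Finsupp.single j 1) = 0)
    (hgd : ∀ j ∈ V', g (d (Finsupp.single j 1)) = 0) :
    ∃ k : (ι →₀ R) →ₗ[R] F, (∀ j ∈ S, k (Finsupp.single j 1) = 0) ∧
      ∀ j ∈ V, g (e (Finsupp.single j 1)) = k (d (Finsupp.single j 1)) := by
  classical
  let K : AddSubgroup ((ι →₀ R) →ₗ[R] F) :=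
    { carrier := {k | ∀ j ∈ S, k (Finsupp.single j 1) = 0}
      zero_mem' := fun j _ => rfl
      add_mem' := fun {a b} ha hb j hj => by rw [LinearMap.add_apply, ha j hj, hb j hj, add_zero]
      neg_mem' := fun {a} ha j hj => by rw [LinearMap.neg_apply, ha j hj, neg_zero] }
  let Φ : K →+ (V → F) :=
    { toFun := fun k v => k.1 (d (Finsupp.single v.1 1))
      map_zero' := rfl
      map_add' := fun _ _ => rfl }
  let t : V → F := fun v => g (e (Finsupp.single v.1 1))
  suffices ht : t ∈ Φ.range by
    obtain ⟨k, hk⟩ := ht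
    exact ⟨k.1, k.2, fun j hj => (congrFun hk ⟨j, hj⟩).symm⟩
  by_contra ht
  obtain ⟨c, hc⟩ := CharacterModule.exists_character_apply_ne_zero_of_ne_zero
    (a := (QuotientAddGroup.mk t : (V → F) ⧸ Φ.range))
    (fun h => ht ((QuotientAddGroup.eq_zero_iff t).1 h))
  let χ : (V → F) →+ AddCircle (1 : ℚ) :=
    AddMonoidHom.comp (c : ((V → F) ⧸ Φ.range) →+ AddCircle (1 : ℚ))
      (QuotientAddGroup.mk' Φ.range)
  have hχΦ : ∀ k, χ (Φ k) = 0 := fun k => by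
    have : (QuotientAddGroup.mk' Φ.range) (Φ k) = 0 :=
      (QuotientAddGroup.eq_zero_iff _).2 ⟨k, rfl⟩
    change c _ = 0
    rw [this]
    exact map_zero c
  have hχt : χ t ≠ 0 := hc
  let χv : V → RightDual F := fun v => χ.comp (AddMonoidHom.single (fun _ : V => F) v)
  have hχv : ∀ f : V → F, χ f = ∑ v, χv v (f v) := by
    intro f
    conv_lhs => rw [← Finset.univ_sum_single f]
    rw [map_sum]
    rfl
  let y : ι →₀ RightDual F := Finsupp.onFinset V
    (fun j => if h : j ∈ V then χv ⟨j, h⟩ else 0) (fun j hj => by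
      by_contra hjV
      exact hj (dif_neg hjV))
  have hyV : SuppIn (V : Set ι) y := fun j hj => dif_neg hj
  have hyv : ∀ v : V, y v.1 = χv v := fun v => dif_pos v.2
  have hsum : ∀ f : ι → RightDual F → AddCircle (1 : ℚ), (∀ j, f j 0 = 0) →
      y.sum f = ∑ v : V, f v.1 (χv v) := by
    intro f hf
    rw [Finsupp.sum_of_support_subset y (s := V) (fun j hj => hyV.mem hj) f (fun j _ => hf j),
      ← Finset.sum_coe_sort]
    exact Finset.sum_congr rfl fun v _ => by rw [hyv]
  have hyS : SuppIn S (coordMap (RightDual F) d y) := by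
    intro j hj
    refine RightDual.ext fun f => ?_
    rw [coordMap_apply]
    have h1 : (y.sum fun i χ => MulOpposite.op (d (Finsupp.single i 1) j) • χ) f =
        y.sum fun i χ => χ (d (Finsupp.single i 1) j • f) :=
      map_finsuppSum (AddMonoidHom.eval f : (F →+ AddCircle (1 : ℚ)) →+ AddCircle (1 : ℚ)) y _
    rw [h1, hsum _ (fun _ => rfl), RightDual.zero_apply]
    -- The test cochain is the j-th coordinate times f; it vanishes on `S` because j ∉ S.
    have h2 := hχΦ ⟨(Finsupp.lapply j).smulRight f, fun i hi => by
      have hij : i ≠ j := fun h => hj (h ▸ hi)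
      simp [hij]⟩
    rw [hχv] at h2
    exact h2
  obtain ⟨w, hw, hwS⟩ := hV (RightDual F) RightDual.injective_of_projective y hyV hyS
  apply hχt
  have h3 : dualPairing (g ∘ₗ e) y = χ t := by
    rw [hχv, dualPairing_apply, hsum _ (fun _ => rfl)]
    rfl
  have h4 := dualPairing_eq_zero (g := g) hwS hgS
  rw [map_sub, dualPairing_coordMap, dualPairing_coordMap, h3,
    dualPairing_eq_zero (g := g ∘ₗ d) hw hgd, sub_zero] at h4
  exact h4

namespace IsSummandDifferential

variable (H : IsSummandDifferential d e)
include H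

/-- The boundary d y is a cycle supported in `S`, so d y = d z with z supported in `S`. Exactness of
the whole complex applies to the cycle y - z. -/
theorem boundsIn_univ (hu : IsExactSet d e Set.univ) (hS : IsExactSet d e S) :
    BoundsIn d e S Set.univ Set.univ := by
  intro I _ _ hI y _ hdy
  obtain ⟨z, hz, hdz⟩ := hS.exact I hI _ hdy (by rw [coordMap_coordMap, H.d_d, coordMap_zero])
  rw [coordMap_coordMap, H.e_d] at hdz
  obtain ⟨w, hw, hdw⟩ := hu.exact I hI (y - z) (fun j hj => absurd trivial hj)
    (by rw [map_sub, hdz, sub_self])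
  refine ⟨w, hw, ?_⟩
  rw [map_sub] at hdw
  rw [← hdw, sub_sub_cancel]
  exact hS.stable_e.coordMap hz

/-- Compactness: suppose every finite V' has a counterexample y_{V'} over some I_{V'}. The product
of the I_{V'} is injective, and the y_{V'}, all supported in the finite set `V`, form one chain over
it. A chain w bounding it modulo `S` has finite support, and its component at V' = supp w
contradicts the choice of y_{V'}. -/
theorem exists_boundsIn (hu : IsExactSet d e Set.univ) (hS : IsExactSet d e S) (V : Finset ι) :
    ∃ V' : Finset ι, BoundsIn d e S V V' := by
  classical
  by_contra! hcon
  have hcon' : ∀ V' : Finset ι, ∃ (I : Type u) (_ : AddCommGroup I) (_ : Module Rᵐᵒᵖ I)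
      (_ : Module.Injective Rᵐᵒᵖ I) (y : ι →₀ I), SuppIn (V : Set ι) y ∧
        SuppIn S (coordMap I d y) ∧ ∀ w : ι →₀ I, SuppIn (V' : Set ι) w →
          ¬ SuppIn S (coordMap I e y - coordMap I d w) := by
    intro V'
    have h := hcon V'
    unfold BoundsIn at h
    push Not at h
    obtain ⟨I, i₁, i₂, i₃, y, h₁, h₂, h₃⟩ := h
    exact ⟨I, i₁, i₂, i₃, y, h₁, h₂, h₃⟩
  choose I i₁ i₂ i₃ y hyV hyS hno using hcon'
  let y' : ι →₀ (∀ V', I V') := Finsupp.onFinset V (fun j V' => y V' j) (fun j hj => by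
    by_contra hjV
    exact hj (funext fun V' => hyV V' j hjV))
  have hproj : ∀ V', Finsupp.mapRange.addMonoidHom
      (LinearMap.proj (R := Rᵐᵒᵖ) (φ := I) V').toAddMonoidHom y' = y V' := fun V' => by
    ext j
    rfl
  obtain ⟨w, -, hw⟩ := H.boundsIn_univ hu hS (∀ V', I V') inferInstance y'
    (fun j hj => absurd trivial hj) (fun j hj => funext fun V' => by
      have h := hyS V' j hj
      rw [← hproj V', coordMap_mapRange] at h
      exact h)
  refine hno w.support (Finsupp.mapRange.addMonoidHom
    (LinearMap.proj (R := Rᵐᵒᵖ) (φ := I) w.support).toAddMonoidHom w) (fun j hj => ?_)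
      (fun j hj => ?_)
  · have : w j = 0 := by simpa using hj
    change w j _ = 0
    rw [this]
    rfl
  · rw [← hproj, coordMap_mapRange, coordMap_mapRange, ← map_sub]
    exact congrFun (hw j hj) _

variable {F : Type u} [AddCommGroup F] [Module R F] [Module.Projective R F]

/-- On the span of countably many basis vectors modulo `S`, a cocycle that vanishes on `S` is a
coboundary of a map that vanishes on `S`. -/
theorem exists_primitive_of_sequence (hSd : IsStableSet d S) (hSe : IsStableSet e S)
    (V : ℕ → Finset ι) (hV : Monotone V)
    (hB : ∀ n, BoundsIn d e S (V n) (V (n + 1)))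
    (hd : ∀ n, ∀ j ∈ V n, SuppIn (V (n + 1) : Set ι) (d (Finsupp.single j 1)))
    (g : (ι →₀ R) →ₗ[R] F) (hgS : ∀ j ∈ S, g (Finsupp.single j 1) = 0) (hgd : g ∘ₗ d = 0)
    (hge : g ∘ₗ e = g) :
    ∃ k : (ι →₀ R) →ₗ[R] F, (∀ j ∈ S, k (Finsupp.single j 1) = 0) ∧
      ∀ n, ∀ j ∈ V n, g (Finsupp.single j 1) = k (d (Finsupp.single j 1)) := by
  classical
  -- A solution at stage n is valid on V (n + 1), one step beyond the set V n on which its values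
  -- are kept; this margin is what the correction at the next stage consumes.
  let K (n : ℕ) (k : (ι →₀ R) →ₗ[R] F) : Prop := (∀ j ∈ S, k (Finsupp.single j 1) = 0) ∧
    k ∘ₗ e = k ∧ ∀ j ∈ V (n + 1), g (Finsupp.single j 1) = k (d (Finsupp.single j 1))
  have hvan : ∀ (k : (ι →₀ R) →ₗ[R] F) (a : (ι →₀ R) →ₗ[R] (ι →₀ R)), IsStableSet a S →
      (∀ j ∈ S, k (Finsupp.single j 1) = 0) → ∀ j ∈ S, k (a (Finsupp.single j 1)) = 0 :=
    fun k a ha hk j hj => (ha j hj).map_eq (g := 0) hk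
  have hgde : ∀ x, g (d x) = 0 := fun x => LinearMap.congr_fun hgd x
  have hex : ∀ n, ∃ k, K n k := by
    intro n
    obtain ⟨k, hkS, hk⟩ := (hB (n + 1)).exists_factor g hgS (fun j _ => hgde _)
    refine ⟨k ∘ₗ e, hvan k e hSe hkS, by rw [LinearMap.comp_assoc, H.e_e], fun j hj => ?_⟩
    have h1 := hk j hj
    rw [LinearMap.comp_apply, ← LinearMap.comp_apply e d, H.e_d, ← h1]
    exact (LinearMap.congr_fun hge _).symm
  have hstep : ∀ n k, K n k → ∃ k', K (n + 1) k' ∧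
      ∀ j ∈ V n, k' (Finsupp.single j 1) = k (Finsupp.single j 1) := by
    rintro n k ⟨hkS, hke, hk⟩
    obtain ⟨k₁, hk₁S, hk₁e, hk₁⟩ := hex (n + 1)
    -- Both k₁ and k solve the equation on V (n + 1), so their difference kills d there and equals l
    -- d on V n. Subtracting l d from k₁ leaves k₁ d unchanged.
    obtain ⟨l, hlS, hl⟩ := (hB n).exists_factor (k₁ - k)
      (fun j hj => by rw [LinearMap.sub_apply, hk₁S j hj, hkS j hj, sub_zero])
      (fun j hj => by
        rw [LinearMap.sub_apply, ← hk₁ j (hV (Nat.le_succ _) hj), ← hk j hj, sub_self])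
    refine ⟨k₁ - l ∘ₗ d, ⟨fun j hj => ?_, ?_, fun j hj => ?_⟩, fun j hj => ?_⟩
    · rw [LinearMap.sub_apply, hk₁S j hj, LinearMap.comp_apply, hvan l d hSd hlS j hj, sub_zero]
    · rw [LinearMap.sub_comp, hk₁e, LinearMap.comp_assoc, H.d_e]
    · rw [LinearMap.sub_apply, ← hk₁ j hj, LinearMap.comp_apply, ← LinearMap.comp_apply d d, H.d_d,
        LinearMap.zero_apply, map_zero, sub_zero]
    · have h1 := hl j hj
      rw [← LinearMap.comp_apply, LinearMap.sub_comp, hk₁e, hke, LinearMap.sub_apply] at h1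
      rw [LinearMap.sub_apply, LinearMap.comp_apply, ← h1, sub_sub_cancel]
  choose! nxt hnxt using hstep
  obtain ⟨k₀, hk₀⟩ := hex 0
  let k : ℕ → (ι →₀ R) →ₗ[R] F := fun n => Nat.rec k₀ (fun n k => nxt n k) n
  have hk : ∀ n, K n (k n) := by
    intro n
    induction n with
    | zero => exact hk₀
    | succ n ih => exact (hnxt n (k n) ih).1
  have hk' : ∀ n, ∀ j ∈ V n, k (n + 1) (Finsupp.single j 1) = k n (Finsupp.single j 1) :=
    fun n => (hnxt n (k n) (hk n)).2
  have hkm : ∀ n m, n ≤ m → ∀ j ∈ V n, k m (Finsupp.single j 1) = k n (Finsupp.single j 1) := by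
    intro n m hnm j hj
    induction m, hnm using Nat.le_induction with
    | base => rfl
    | succ m hm ih => rw [hk' m j (hV hm hj), ih]
  -- The values at j are constant from the first stage containing j on. Outside all stages the value
  -- 0 keeps f zero on `S`.
  let f : (ι →₀ R) →ₗ[R] F := Finsupp.linearCombination R fun j =>
    if h : ∃ n, j ∈ V n then k (Nat.find h) (Finsupp.single j 1) else 0
  have hf : ∀ n, ∀ j ∈ V n, f (Finsupp.single j 1) = k n (Finsupp.single j 1) := by
    intro n j hj
    have h : ∃ n, j ∈ V n := ⟨n, hj⟩
    simp only [f, Finsupp.linearCombination_single, one_smul, dif_pos h]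
    exact (hkm _ _ (Nat.find_min' h hj) j (Nat.find_spec h)).symm
  refine ⟨f, fun j hj => ?_, fun n j hj => ?_⟩
  · simp only [f, Finsupp.linearCombination_single, one_smul]
    split_ifs with h
    · exact (hk _).1 j hj
    · rfl
  · rw [(hd n j hj).map_eq (f := f) (hf (n + 1))]
    exact (hk (n + 1)).2.2 j (hV (by omega) hj)

/-- An exact set can be enlarged by countably many elements, one of which is prescribed, so that
it stays exact and cocycles that vanish on the smaller set are coboundaries on the larger one. -/
theorem exists_enlargement (hu : IsExactSet d e Set.univ) (hS : IsExactSet d e S) (i : ι) :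
    ∃ T : Set ι, S ⊆ T ∧ i ∈ T ∧ IsExactSet d e T ∧
      ∀ g : (ι →₀ R) →ₗ[R] F, (∀ j ∈ S, g (Finsupp.single j 1) = 0) → g ∘ₗ d = 0 → g ∘ₗ e = g →
        ∃ k : (ι →₀ R) →ₗ[R] F, (∀ j ∈ S, k (Finsupp.single j 1) = 0) ∧
          ∀ j ∈ T, g (Finsupp.single j 1) = k (d (Finsupp.single j 1)) := by
  classical
  choose U hU using H.exists_boundsIn hu hS
  -- Starting from {i}, each step adds a finite set in which the cycles of the previous one bound,
  -- and the supports of `d` and `e` on it.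
  let V : ℕ → Finset ι := fun n => (fun V : Finset ι => V ∪ (U V ∪
    V.biUnion fun j => (d (Finsupp.single j 1)).support ∪ (e (Finsupp.single j 1)).support))^[n] {i}
  have hVs : ∀ n, V (n + 1) = V n ∪ (U (V n) ∪ (V n).biUnion fun j =>
    (d (Finsupp.single j 1)).support ∪ (e (Finsupp.single j 1)).support) :=
    fun n => Function.iterate_succ_apply' _ n _
  have hV : Monotone V := monotone_nat_of_le_succ fun n => by
    rw [hVs]
    exact Finset.subset_union_left
  have hB : ∀ n : ℕ, BoundsIn d e S (V n) (V (n + 1)) := by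
    intro n
    refine BoundsIn.mono (hU (V n)) fun j hj => ?_
    rw [hVs]
    exact Finset.mem_coe.2 (Finset.mem_union_right _ (Finset.mem_union_left _ hj))
  have hd : ∀ n, ∀ j ∈ V n, SuppIn (V (n + 1) : Set ι) (d (Finsupp.single j 1)) := by
    intro n j hj l hl
    by_contra hne
    refine hl ?_
    rw [hVs]
    exact Finset.mem_union_right _ (Finset.mem_union_right _ (Finset.mem_biUnion.2
      ⟨j, hj, Finset.mem_union_left _ (Finsupp.mem_support_iff.2 hne)⟩))
  have he : ∀ n, ∀ j ∈ V n, SuppIn (V (n + 1) : Set ι) (e (Finsupp.single j 1)) := by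
    intro n j hj l hl
    by_contra hne
    refine hl ?_
    rw [hVs]
    exact Finset.mem_union_right _ (Finset.mem_union_right _ (Finset.mem_biUnion.2
      ⟨j, hj, Finset.mem_union_right _ (Finsupp.mem_support_iff.2 hne)⟩))
  have hVT : ∀ n, (V n : Set ι) ⊆ S ∪ ⋃ n, (V n : Set ι) := fun n =>
    (Set.subset_iUnion (fun n => (V n : Set ι)) n).trans Set.subset_union_right
  have hst : ∀ a : (ι →₀ R) →ₗ[R] (ι →₀ R), IsStableSet a S →
      (∀ n, ∀ j ∈ V n, SuppIn (V (n + 1) : Set ι) (a (Finsupp.single j 1))) →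
      IsStableSet a (S ∪ ⋃ n, (V n : Set ι)) := by
    rintro a haS haV j (hj | hj)
    · exact (haS j hj).mono Set.subset_union_left
    · obtain ⟨n, hn⟩ := Set.mem_iUnion.1 hj
      exact (haV n j hn).mono (hVT _)
  refine ⟨S ∪ ⋃ n, (V n : Set ι), Set.subset_union_left,
    hVT 0 (Finset.mem_coe.2 (Finset.mem_singleton_self i)),
    ⟨hst d hS.stable_d hd, hst e hS.stable_e he, ?_⟩, ?_⟩
  · intro I _ _ hI y hy hdy
    -- Split y into y₁ on `S` and y₂ on some V n. As y₂ is a cycle modulo `S`, e y₂ is a boundary d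
    -- w modulo `S`, and e y - d w is a cycle in `S`, where exactness of `S` applies.
    have hy₁ : SuppIn S (y.filter (· ∈ S)) := fun j hj => Finsupp.filter_apply_neg _ _ hj
    have hsum := Finsupp.filter_add_filter_not y (· ∈ S)
    set y₁ := y.filter (· ∈ S)
    set y₂ := y.filter (fun j => ¬ j ∈ S)
    have hy₂ : ∃ n, SuppIn (V n : Set ι) y₂ := by
      have hfin : ∀ s : Finset ι, (∀ j ∈ s, ∃ n, j ∈ V n) → ∃ n, s ⊆ V n := by
        intro s hs
        choose! m hm using hs
        exact ⟨s.sup m, fun j hj => hV (Finset.le_sup hj) (hm j hj)⟩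
      obtain ⟨n, hn⟩ := hfin y₂.support (fun j hj => by
        have hj' := Finsupp.mem_support_iff.1 hj
        have hjS : j ∉ S := fun h => hj' (Finsupp.filter_apply_neg _ _ (not_not.2 h))
        have hjT : j ∈ S ∪ ⋃ n, (V n : Set ι) := by
          refine hy.mem (Finsupp.mem_support_iff.2 fun h => hj' ?_)
          exact (Finsupp.filter_apply_pos (fun j => ¬ j ∈ S) y hjS).trans h
        simpa using hjT.resolve_left hjS)
      exact ⟨n, fun j hj => Finsupp.notMem_support_iff.1 fun h => hj (hn h)⟩
    obtain ⟨n, hn⟩ := hy₂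
    have hdy₂ : coordMap I d y₂ = -coordMap I d y₁ := by
      rw [← hsum, map_add] at hdy
      exact eq_neg_of_add_eq_zero_right hdy
    obtain ⟨w, hw, hwS⟩ := hB n I hI y₂ hn (by
      rw [hdy₂]
      exact (hS.stable_d.coordMap hy₁).neg)
    have hx : SuppIn S (coordMap I e y - coordMap I d w) := by
      rw [← hsum, map_add, add_sub_assoc]
      exact (hS.stable_e.coordMap hy₁).add hwS
    obtain ⟨z, hz, hdz⟩ := hS.exact I hI _ hx (by
      rw [map_sub, coordMap_coordMap, coordMap_coordMap, H.d_e, H.d_d, hdy, coordMap_zero,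
        sub_zero])
    rw [map_sub, coordMap_coordMap, coordMap_coordMap, H.e_e, H.e_d] at hdz
    refine ⟨w + z, (hw.mono (hVT _)).add (hz.mono Set.subset_union_left), ?_⟩
    rw [map_add, ← hdz, add_sub_cancel]
  · intro g hgS hgd hge
    obtain ⟨k, hkS, hk⟩ := H.exists_primitive_of_sequence hS.stable_d hS.stable_e V hV hB hd g hgS
      hgd hge
    refine ⟨k, hkS, ?_⟩
    rintro j (hj | hj)
    · rw [hgS j hj, (hS.stable_d j hj).map_eq (g := 0) hkS, LinearMap.zero_apply]
    · obtain ⟨n, hn⟩ := Set.mem_iUnion.1 hj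
      exact hk n j hn

/-- If a complex of projective modules stays exact after tensoring with injective right modules,
then all cocycles with values in a projective module are coboundaries. -/
theorem exists_primitive (hu : IsExactSet d e Set.univ) (g : (ι →₀ R) →ₗ[R] F) (hgd : g ∘ₗ d = 0)
    (hge : g ∘ₗ e = g) : ∃ k : (ι →₀ R) →ₗ[R] F, g = k ∘ₗ d := by
  classical
  let A := {p : Set ι × (ι → F) // IsExactSet d e p.1 ∧
    ∀ j ∈ p.1, g (Finsupp.single j 1) = Finsupp.linearCombination R p.2 (d (Finsupp.single j 1))}
  -- Values of the second component outside the set are junk, so only those on the smaller set are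
  -- compared. The relation is transitive but need not be antisymmetric.
  let r : A → A → Prop := fun p q => p.1.1 ⊆ q.1.1 ∧ ∀ j ∈ p.1.1, p.1.2 j = q.1.2 j
  have htrans : ∀ {a b c : A}, r a b → r b c → r a c := fun hab hbc =>
    ⟨hab.1.trans hbc.1, fun j hj => (hab.2 j hj).trans (hbc.2 j (hab.1 hj))⟩
  have hlc : ∀ (S : Set ι) (k k' : ι → F), (∀ j ∈ S, k j = k' j) → ∀ x : ι →₀ R, SuppIn S x →
      Finsupp.linearCombination R k x = Finsupp.linearCombination R k' x :=
    fun S k k' h x hx => hx.map_eq fun j hj => by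
      simp only [Finsupp.linearCombination_single, one_smul, h j hj]
  obtain ⟨⟨⟨S, k⟩, hS, hk⟩, hmax⟩ := exists_maximal_of_chains_bounded (r := r) (fun c hc => by
    let T : Set ι := ⋃ p ∈ c, p.1.1
    let k : ι → F := fun j => if h : ∃ p ∈ c, j ∈ p.1.1 then h.choose.1.2 j else 0
    have hsub : ∀ p ∈ c, p.1.1 ⊆ T := fun p hp =>
      Set.subset_biUnion_of_mem (u := fun p : A => p.1.1) hp
    have hkeq : ∀ p ∈ c, ∀ j ∈ p.1.1, p.1.2 j = k j := by
      intro p hp j hj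
      have h : ∃ p ∈ c, j ∈ p.1.1 := ⟨p, hp, hj⟩
      have hkj : k j = h.choose.1.2 j := dif_pos h
      rw [hkj]
      by_cases heq : p = h.choose
      · rw [← heq]
      · rcases hc hp h.choose_spec.1 heq with h1 | h1
        · exact h1.2 j hj
        · exact (h1.2 j h.choose_spec.2).symm
    have hst : ∀ a : (ι →₀ R) →ₗ[R] (ι →₀ R), (∀ p ∈ c, IsStableSet a p.1.1) →
        IsStableSet a T := by
      intro a ha j hj
      obtain ⟨p, hp, hjp⟩ := Set.mem_iUnion₂.1 hj
      exact (ha p hp j hjp).mono (hsub p hp)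
    refine ⟨⟨⟨T, k⟩, ⟨hst d fun p _ => p.2.1.stable_d, hst e fun p _ => p.2.1.stable_e, ?_⟩, ?_⟩,
      fun p hp => ⟨hsub p hp, hkeq p hp⟩⟩
    · intro I _ _ hI y hy hdy
      -- The empty chain is bounded by the empty set, on which only y = 0 is supported.
      rcases c.eq_empty_or_nonempty with rfl | hne
      · have hy0 : y = 0 := Finsupp.ext fun j => hy j (by simp [T])
        exact ⟨0, fun j _ => rfl, by rw [hy0, map_zero, map_zero]⟩
      · have hfin : ∀ s : Finset ι, (s : Set ι) ⊆ T → ∃ p ∈ c, (s : Set ι) ⊆ p.1.1 := by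
          intro s hs
          induction s using Finset.induction_on with
          | empty =>
            obtain ⟨p, hp⟩ := hne
            exact ⟨p, hp, by simp⟩
          | insert j s _ ih =>
            rw [Finset.coe_insert, Set.insert_subset_iff] at hs
            obtain ⟨p, hp, hps⟩ := ih hs.2
            obtain ⟨q, hq, hjq⟩ := Set.mem_iUnion₂.1 hs.1
            have hor : p.1.1 ⊆ q.1.1 ∨ q.1.1 ⊆ p.1.1 := by
              by_cases heq : p = q
              · exact Or.inl (by rw [heq])
              · exact (hc hp hq heq).imp (fun h => h.1) (fun h => h.1)
            rcases hor with h | h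
            · exact ⟨q, hq, by
                rw [Finset.coe_insert, Set.insert_subset_iff]; exact ⟨hjq, hps.trans h⟩⟩
            · exact ⟨p, hp, by
                rw [Finset.coe_insert, Set.insert_subset_iff]; exact ⟨h hjq, hps⟩⟩
        obtain ⟨p, hp, hps⟩ := hfin y.support (fun j hj => hy.mem hj)
        obtain ⟨w, hw, hdw⟩ := p.2.1.exact I hI y
          (fun j hj => Finsupp.notMem_support_iff.1 fun h => hj (hps h)) hdy
        exact ⟨w, hw.mono (hsub p hp), hdw⟩
    · intro j hj
      obtain ⟨p, hp, hjp⟩ := Set.mem_iUnion₂.1 hj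
      rw [p.2.2 j hjp]
      exact hlc p.1.1 _ _ (hkeq p hp) _ (p.2.1.stable_d j hjp)) htrans
  let f := Finsupp.linearCombination R k
  suffices hSu : ∀ i, i ∈ S from
    ⟨f, Finsupp.lhom_ext' fun j => LinearMap.ext_ring (hk j (hSu j))⟩
  intro i
  by_contra hi
  obtain ⟨T, hST, hiT, hT, hTk⟩ := H.exists_enlargement (F := F) hu hS i
  -- The error g - f d is a cocycle vanishing on `S`. Its primitive l on T vanishes on `S` too, so f
  -- + l still extends the values of f on `S`.
  obtain ⟨l, hlS, hl⟩ := hTk (g - f ∘ₗ d) (fun j hj => sub_eq_zero.2 (hk j hj))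
    (by rw [LinearMap.sub_comp, hgd, LinearMap.comp_assoc, H.d_d, LinearMap.comp_zero, sub_zero])
    (by rw [LinearMap.sub_comp, hge, LinearMap.comp_assoc, H.d_e])
  have hlin : Finsupp.linearCombination R (fun j => k j + l (Finsupp.single j 1)) = f + l := by
    refine Finsupp.lhom_ext' fun j => LinearMap.ext_ring ?_
    simp [f]
  refine hi ((hmax ⟨⟨T, fun j => k j + l (Finsupp.single j 1)⟩, hT, fun j hj => ?_⟩
    ⟨hST, fun j hj => ?_⟩).1 hiT)
  · have h := hl j hj
    dsimp only
    rw [hlin, LinearMap.add_apply, ← h, LinearMap.sub_apply, LinearMap.comp_apply, add_sub_cancel]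
  · dsimp only
    rw [hlS j hj, add_zero]

end IsSummandDifferential

end Cocycles

/-! ### Factoring linear maps through surjections and injections. -/

section LinearMaps

variable {X Y Z : Type u} [AddCommGroup X] [Module R X] [AddCommGroup Y] [Module R Y]
  [AddCommGroup Z] [Module R Z]

theorem exists_desc (f : X →ₗ[R] Y) (hf : Function.Surjective f) (g : X →ₗ[R] Z)
    (h : ∀ x, f x = 0 → g x = 0) : ∃ k : Y →ₗ[R] Z, ∀ x, k (f x) = g x := by
  refine ⟨(LinearMap.ker f).liftQ g h ∘ₗ (f.quotKerEquivOfSurjective hf).symm.toLinearMap,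
    fun x => ?_⟩
  have hx : (f.quotKerEquivOfSurjective hf).symm (f x) = Submodule.Quotient.mk x :=
    (LinearEquiv.symm_apply_eq _).2 rfl
  rw [LinearMap.comp_apply, LinearEquiv.coe_coe, hx]
  rfl

theorem exists_lift_of_injective (f : X →ₗ[R] Y) (hf : Function.Injective f) (g : Z →ₗ[R] Y)
    (h : ∀ z, ∃ x, f x = g z) : ∃ k : Z →ₗ[R] X, ∀ z, f (k z) = g z := by
  choose k hk using h
  refine ⟨{ toFun := k, map_add' := fun a b => hf ?_, map_smul' := fun r a => hf ?_ }, hk⟩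
  · rw [map_add, hk, hk, hk, map_add]
  · rw [map_smul, hk, hk, map_smul, RingHom.id_apply]

end LinearMaps

/-! ### From differential modules to complexes. -/

section Complexes

/-- A projective `T` is a retract, p ∘ s = id, of the free module on its underlying set. The
transported differential s δ p has idempotent s p and inherits the exactness of `T`. -/
theorem exists_primitive_of_differential {T F : Type u} [AddCommGroup T] [Module R T]
    [Module.Projective R T] [AddCommGroup F] [Module R F] [Module.Projective R F] (δ : T →ₗ[R] T)
    (hδ : δ ∘ₗ δ = 0)
    (hex : ∀ (I : Type u) [AddCommGroup I] [Module Rᵐᵒᵖ I], Module.Injective Rᵐᵒᵖ I →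
      ∀ y : BalancedTensor (R := R) I T, BalancedTensor.map I δ y = 0 →
        ∃ w, BalancedTensor.map I δ w = y)
    (g : T →ₗ[R] F) (hg : g ∘ₗ δ = 0) : ∃ k : T →ₗ[R] F, g = k ∘ₗ δ := by
  obtain ⟨s, hs⟩ := Module.projective_def'.1 ‹Module.Projective R T›
  set p : (T →₀ R) →ₗ[R] T := Finsupp.linearCombination R id
  have hps : ∀ x, p (s x) = x := LinearMap.congr_fun hs
  have hδδ : ∀ x, δ (δ x) = 0 := LinearMap.congr_fun hδ
  have H : IsSummandDifferential (s ∘ₗ δ ∘ₗ p) (s ∘ₗ p) := by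
    constructor <;> refine LinearMap.ext fun x => ?_ <;> simp [hps, hδδ]
  have hu : IsExactSet (s ∘ₗ δ ∘ₗ p) (s ∘ₗ p) Set.univ := by
    refine ⟨fun j _ l hl => absurd trivial hl, fun j _ l hl => absurd trivial hl, ?_⟩
    intro I _ _ hI y _ hy
    have h1 : BalancedTensor.map I δ (BalancedTensor.map I p (ofCoords I y)) = 0 := by
      have h := congrArg (fun z => BalancedTensor.map I p (ofCoords I z)) hy
      simp only [coordMap_def, ofCoords_toCoords, map_zero, BalancedTensor.map_map] at h
      rw [BalancedTensor.map_map, ← h]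
      congr 2
      exact LinearMap.ext fun x => (hps _).symm
    obtain ⟨w, hw⟩ := hex I hI _ h1
    refine ⟨toCoords I (BalancedTensor.map I s w), fun j hj => absurd trivial hj, ?_⟩
    rw [coordMap_def, coordMap_def, ofCoords_toCoords, BalancedTensor.map_map,
      ← BalancedTensor.map_map I s p, ← hw, BalancedTensor.map_map]
    congr 3
    exact LinearMap.ext fun x => by simp [hps]
  have hgδ : ∀ x, g (δ x) = 0 := LinearMap.congr_fun hg
  obtain ⟨k, hk⟩ := H.exists_primitive hu (g ∘ₗ p) (LinearMap.ext fun x => by simp [hps, hgδ])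
    (LinearMap.ext fun x => by simp [hps])
  refine ⟨k ∘ₗ s, LinearMap.ext fun x => ?_⟩
  have h := LinearMap.congr_fun hk (s x)
  simpa [hps] using h

variable {S : Type*} [Ring S]

theorem exact_of_acyclic {K : ChainComplex (ModuleCat.{u} S) ℤ} (hK : K.Acyclic) {i j k : ℤ}
    (hij : j + 1 = i) (hjk : k + 1 = j) : Function.Exact (K.d i j).hom (K.d j k).hom := by
  have h := (K.exactAt_iff' i j k (by simp [hij]) (by simp [← hjk])).1 (hK j)
  exact (ShortComplex.ShortExact.moduleCat_exact_iff_function_exact _).1 h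

theorem acyclic_of_exact (K : ChainComplex (ModuleCat.{u} S) ℤ)
    (h : ∀ n, Function.Exact (K.d (n + 1 + 1) (n + 1)).hom (K.d (n + 1) n).hom) : K.Acyclic := by
  intro j
  obtain ⟨n, rfl⟩ : ∃ n, j = n + 1 := ⟨j - 1, by ring⟩
  rw [K.exactAt_iff' (n + 1 + 1) (n + 1) n (by simp) (by simp)]
  exact (ShortComplex.ShortExact.moduleCat_exact_iff_function_exact _).2 (h n)

theorem nonempty_cycles_iso (K : ChainComplex (ModuleCat.{u} S) ℤ) {i j : ℤ} (hij : j + 1 = i) :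
    Nonempty (K.cycles i ≅ ModuleCat.of S (LinearMap.ker (K.d i j).hom)) :=
  ⟨(K.cyclesIsKernel i j (by simp [← hij])).conePointUniqueUpToIso
    (ModuleCat.kernelIsLimit (K.d i j))⟩

theorem tensor_exact_of_acyclic {N : ModuleCat.{u} Rᵐᵒᵖ} {P : ChainComplex (ModuleCat.{u} R) ℤ}
    (h : (((tensorFunctor (R := R) N).mapHomologicalComplex (ComplexShape.down ℤ)).obj P).Acyclic)
    {i j k : ℤ} (hij : j + 1 = i) (hjk : k + 1 = j) :
    Function.Exact (BalancedTensor.map N (P.d i j).hom) (BalancedTensor.map N (P.d j k).hom) :=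
  exact_of_acyclic h hij hjk

/-- The sum of the differentials of a complex. -/
def totalDifferential (P : ChainComplex (ModuleCat.{u} R) ℤ) :
    DirectSum ℤ (fun n => P.X n) →ₗ[R] DirectSum ℤ (fun n => P.X n) :=
  DirectSum.toModule R ℤ _ fun n =>
    DirectSum.lof R ℤ (fun n => P.X n) (n - 1) ∘ₗ (P.d n (n - 1)).hom

theorem totalDifferential_lof (P : ChainComplex (ModuleCat.{u} R) ℤ) {i j : ℤ} (hij : j + 1 = i)
    (x : P.X i) : totalDifferential P (DirectSum.lof R ℤ (fun n => P.X n) i x) =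
      DirectSum.lof R ℤ (fun n => P.X n) j ((P.d i j).hom x) := by
  obtain rfl : j = i - 1 := by omega
  rw [totalDifferential, DirectSum.toModule_lof]
  rfl

theorem totalDifferential_apply (P : ChainComplex (ModuleCat.{u} R) ℤ) {i j : ℤ} (hij : j + 1 = i)
    (x : DirectSum ℤ (fun n => P.X n)) : totalDifferential P x j = (P.d i j).hom (x i) := by
  induction x using DirectSum.induction_on with
  | zero => simp
  | add x y hx hy => rw [map_add, DirectSum.add_apply, DirectSum.add_apply, map_add, hx, hy]
  | of n x =>
    change totalDifferential P (DirectSum.lof R ℤ (fun n => P.X n) n x) j =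
      (P.d i j).hom (DirectSum.lof R ℤ (fun n => P.X n) n x i)
    rw [totalDifferential_lof P (show (n - 1) + 1 = n by ring)]
    by_cases hn : n = i
    · subst hn
      obtain rfl : j = n - 1 := by omega
      rw [DirectSum.lof_apply, DirectSum.lof_apply]
    · rw [DirectSum.lof_eq_of, DirectSum.lof_eq_of, DirectSum.of_eq_of_ne _ _ _ (by omega),
        DirectSum.of_eq_of_ne _ _ _ (by omega), map_zero]

/-- An element of a tensor product with a direct sum is the sum of its components. -/
theorem BalancedTensor.exists_sum_components {J : Type} [DecidableEq J] {A : J → Type u}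
    [∀ j, AddCommGroup (A j)] [∀ j, Module R (A j)] (N : Type u) [AddCommGroup N] [Module Rᵐᵒᵖ N]
    (x : BalancedTensor (R := R) N (DirectSum J A)) :
    ∃ s : Finset J, x = ∑ j ∈ s, BalancedTensor.map N (DirectSum.lof R J A j)
      (BalancedTensor.map N (DirectSum.component R J A j) x) := by
  suffices h : ∃ s : Finset J, ∀ t, s ⊆ t →
      x = ∑ j ∈ t, BalancedTensor.map N (DirectSum.lof R J A j)
        (BalancedTensor.map N (DirectSum.component R J A j) x) by
    obtain ⟨s, hs⟩ := h
    exact ⟨s, hs s subset_rfl⟩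
  induction x using BalancedTensor.induction with
  | zero => exact ⟨∅, fun t _ => by simp⟩
  | add y z hy hz =>
    obtain ⟨s, hs⟩ := hy
    obtain ⟨s', hs'⟩ := hz
    refine ⟨s ∪ s', fun t ht => ?_⟩
    simp only [_root_.map_add, Finset.sum_add_distrib]
    rw [← hs t (Finset.union_subset_left ht), ← hs' t (Finset.union_subset_right ht)]
  | tmul n x =>
    classical
    refine ⟨DFinsupp.support x, fun t ht => ?_⟩
    have hx : x = ∑ j ∈ t, DirectSum.lof R J A j (DirectSum.component R J A j x) := by
      conv_lhs => rw [← DirectSum.sum_support_of x]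
      refine Finset.sum_subset ht fun j _ hj => ?_
      rw [DFinsupp.notMem_support_iff.1 hj, map_zero]
    have hsum : ∀ f : J → DirectSum J A, (BalancedTensor.tmul n (∑ j ∈ t, f j) :
        BalancedTensor (R := R) N (DirectSum J A)) = ∑ j ∈ t, BalancedTensor.tmul n (f j) :=
      fun f => map_sum (⟨⟨BalancedTensor.tmul n, BalancedTensor.tmul_zero n⟩,
        BalancedTensor.tmul_add n⟩ :
          DirectSum J A →+ BalancedTensor (R := R) N (DirectSum J A)) f t
    conv_lhs => rw [hx, hsum]
    rfl

/-- All degrees are summed to one differential module, which frees the transfinite argument from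
gradings. The cocycle is extended by zero to other degrees, and the resulting primitive is
restricted to degree `k`. -/
theorem exists_primitive_of_complex {P : ChainComplex (ModuleCat.{u} R) ℤ}
    (hP : ∀ m, Projective (P.X m))
    (hex : ∀ N : ModuleCat.{u} Rᵐᵒᵖ, Injective N →
      (((tensorFunctor (R := R) N).mapHomologicalComplex (ComplexShape.down ℤ)).obj P).Acyclic)
    {F : Type u} [AddCommGroup F] [Module R F] [Module.Projective R F] {i j k : ℤ}
    (hij : j + 1 = i) (hjk : k + 1 = j) (g : P.X j →ₗ[R] F) (hg : ∀ x, g ((P.d i j).hom x) = 0) :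
    ∃ f : P.X k →ₗ[R] F, ∀ x, f ((P.d j k).hom x) = g x := by
  have hP' : ∀ m, Module.Projective R (P.X m) := fun m =>
    (IsProjective.iff_projective (P.X m)).2 (hP m)
  have hlof : ∀ n : ℤ, DirectSum.lof R ℤ (fun n => P.X n) n ∘ₗ (P.d (n + 1) n).hom =
      totalDifferential P ∘ₗ DirectSum.lof R ℤ (fun n => P.X n) (n + 1) := fun n =>
    LinearMap.ext fun x => (totalDifferential_lof P rfl x).symm
  have hcomp : ∀ n : ℤ, DirectSum.component R ℤ (fun n => P.X n) n ∘ₗ totalDifferential P =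
      (P.d (n + 1) n).hom ∘ₗ DirectSum.component R ℤ (fun n => P.X n) (n + 1) := fun n =>
    LinearMap.ext fun x => totalDifferential_apply P rfl x
  have hdd : ∀ (a b c : ℤ) (x : P.X a), (P.d b c).hom ((P.d a b).hom x) = 0 := fun a b c x => by
    rw [← LinearMap.comp_apply, ← ModuleCat.hom_comp, P.d_comp_d]
    rfl
  obtain ⟨f, hf⟩ := exists_primitive_of_differential (totalDifferential P) (by
    refine LinearMap.ext fun x => DirectSum.ext fun n => ?_
    rw [LinearMap.comp_apply, totalDifferential_apply P rfl, totalDifferential_apply P rfl, hdd]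
    rfl) (by
    intro I _ _ hI y hy
    have hacyc := hex (ModuleCat.of Rᵐᵒᵖ I) ((Module.injective_iff_injective_object Rᵐᵒᵖ I).1 hI)
    have hc : ∀ n : ℤ, ∃ w : BalancedTensor (R := R) I (P.X (n + 1)),
        BalancedTensor.map I (P.d (n + 1) n).hom w =
          BalancedTensor.map I (DirectSum.component R ℤ (fun n => P.X n) n) y := by
      intro n
      have h := tensor_exact_of_acyclic hacyc (i := n + 1) (j := n) (k := n - 1) rfl (by ring)
      refine (h _).1 ?_
      have h1 := hcomp (n - 1)
      -- The degrees `n - 1 + 1` and `n` agree only propositionally; a variable degree allows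
      -- substitution.
      have h2 : ∀ m, m = n → BalancedTensor.map I (P.d m (n - 1)).hom
          (BalancedTensor.map I (DirectSum.component R ℤ (fun n => P.X n) m) y) = 0 := by
        intro m hm
        obtain rfl : m = n - 1 + 1 := by omega
        rw [BalancedTensor.map_map, ← h1, ← BalancedTensor.map_map, hy, map_zero]
      exact h2 n rfl
    choose w hw using hc
    obtain ⟨s, hs⟩ := BalancedTensor.exists_sum_components I y
    refine ⟨∑ n ∈ s, BalancedTensor.map I (DirectSum.lof R ℤ (fun n => P.X n) (n + 1)) (w n), ?_⟩
    rw [map_sum, hs]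
    refine Finset.sum_congr rfl fun n _ => ?_
    rw [← hw n, BalancedTensor.map_map, BalancedTensor.map_map, hlof])
    (g ∘ₗ DirectSum.component R ℤ (fun n => P.X n) j) (by
      refine LinearMap.ext fun x => ?_
      change g (totalDifferential P x j) = 0
      rw [totalDifferential_apply P hij, hg])
  refine ⟨f ∘ₗ DirectSum.lof R ℤ (fun n => P.X n) k, fun x => ?_⟩
  rw [LinearMap.comp_apply, ← totalDifferential_lof P hjk, ← LinearMap.comp_apply, ← hf,
    LinearMap.comp_apply]
  exact congrArg g (DirectSum.component.lof_self R (M := fun n => P.X n) j x)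

end Complexes

/-! ### Stable classes, splicing, and vanishing of Ext into projectives. -/

section StableClasses

/-- The linear map `f` stays injective after tensoring with the right modules in `B`. -/
def TensorInjective (B : ObjectProperty (ModuleCat.{u} Rᵐᵒᵖ)) {X Y : Type u} [AddCommGroup X]
    [Module R X] [AddCommGroup Y] [Module R Y] (f : X →ₗ[R] Y) : Prop :=
  ∀ N : ModuleCat.{u} Rᵐᵒᵖ, B N → Function.Injective (BalancedTensor.map N f)

/-- A `B ⊗ -`-exact short exact sequence `0 → X → P → Y → 0` with `P` projective. -/
def ProjectiveStep (B : ObjectProperty (ModuleCat.{u} Rᵐᵒᵖ)) (X Y : Type u) [AddCommGroup X]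
    [Module R X] [AddCommGroup Y] [Module R Y] : Prop :=
  ∃ (P : ModuleCat.{u} R) (i : X →ₗ[R] P) (p : P →ₗ[R] Y), Module.Projective R P ∧
    Function.Injective i ∧ Function.Exact i p ∧ Function.Surjective p ∧ TensorInjective B i

/-- Every member of the class `C` is the kernel and the cokernel of a `B ⊗ -`-exact short exact
sequence with projective middle term and other end in `C`. -/
structure IsStableClass (B : ObjectProperty (ModuleCat.{u} Rᵐᵒᵖ))
    (C : ObjectProperty (ModuleCat.{u} R)) : Prop where
  left : ∀ M, C M → ∃ K, C K ∧ ProjectiveStep B K M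
  right : ∀ M, C M → ∃ K, C K ∧ ProjectiveStep B M K

theorem exists_int_sequence {A : Type*} (S : A → A → Prop) (hl : ∀ a, ∃ b, S b a)
    (hr : ∀ a, ∃ b, S a b) (a : A) : ∃ z : ℤ → A, z 1 = a ∧ ∀ n, S (z (n + 1)) (z n) := by
  choose l hl using hl
  choose r hr using hr
  let z : ℤ → A := fun n => Int.casesOn n (fun k => l^[k] a) (fun k => r^[k + 1] a)
  have hz : ∀ n, S (z (n + 1)) (z n) := by
    rintro (k | k)
    · change S (l^[k + 1] a) (l^[k] a)
      rw [Function.iterate_succ_apply']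
      exact hl _
    · cases k with
      | zero => exact hr a
      | succ k =>
        have h : Int.negSucc (k + 1) + 1 = Int.negSucc k := rfl
        rw [h]
        change S (r^[k + 1] a) (r^[k + 1 + 1] a)
        rw [Function.iterate_succ_apply' r (k + 1)]
        exact hr _
  -- The shift puts `a` in degree 1, because the cycles of the spliced complex in degree n are the
  -- term with index n + 1.
  refine ⟨fun n => z (n - 1), rfl, fun n => ?_⟩
  have h := hz (n - 1)
  rwa [show n - 1 + 1 = n + 1 - 1 by ring] at h

variable {B : ObjectProperty (ModuleCat.{u} Rᵐᵒᵖ)}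

/-- Steps chosen indefinitely to the left and right of M splice to a complex with differentials
P_{n+1} → z_{n+1} → P_n, a surjection followed by an injection. The injections survive tensoring
with `B`, so the complex stays exact. -/
theorem IsStableClass.le_PGF {C : ObjectProperty (ModuleCat.{u} R)} (hC : IsStableClass B C) :
    C ≤ PGF B := by
  intro M hM
  obtain ⟨z, hz1, hz⟩ := exists_int_sequence
    (fun X Y : {X : ModuleCat.{u} R // C X} => ProjectiveStep B X.1 Y.1)
    (fun X => by
      obtain ⟨K, hK, h⟩ := hC.left X.1 X.2
      exact ⟨⟨K, hK⟩, h⟩)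
    (fun X => by
      obtain ⟨K, hK, h⟩ := hC.right X.1 X.2
      exact ⟨⟨K, hK⟩, h⟩) ⟨M, hM⟩
  choose P i p hP hi hex hp hT using hz
  let K : ChainComplex (ModuleCat.{u} R) ℤ := ChainComplex.of P
    (fun n => ModuleCat.ofHom (i n ∘ₗ p (n + 1))) (fun n => by
      rw [← ModuleCat.ofHom_comp]
      have : (i n ∘ₗ p (n + 1)) ∘ₗ i (n + 1) ∘ₗ p (n + 1 + 1) = 0 := by
        refine LinearMap.ext fun x => ?_
        have h : p (n + 1) (i (n + 1) (p (n + 1 + 1) x)) = 0 := (hex (n + 1) _).2 ⟨_, rfl⟩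
        simp [h]
      rw [this]
      rfl)
  have hd : ∀ n, (K.d (n + 1) n).hom = i n ∘ₗ p (n + 1) := fun n => by
    change (ChainComplex.of.d P _ (n + 1) n).hom = _
    rw [ChainComplex.of_d]
    rfl
  have hker : ∀ n x, (K.d (n + 1) n).hom x = 0 ↔ p (n + 1) x = 0 := fun n x => by
    rw [hd, LinearMap.comp_apply]
    exact map_eq_zero_iff _ (hi n)
  refine ⟨K, fun m => (IsProjective.iff_projective (P m)).1 (hP m), acyclic_of_exact K fun n x => ?_,
    fun N hN => acyclic_of_exact _ fun n => ?_, ?_⟩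
  · rw [hker]
    refine (hex (n + 1) x).trans ⟨?_, ?_⟩
    · rintro ⟨y, rfl⟩
      obtain ⟨w, rfl⟩ := hp (n + 1 + 1) y
      exact ⟨w, by rw [hd]; rfl⟩
    · rintro ⟨y, rfl⟩
      exact ⟨p (n + 1 + 1) y, by rw [hd]; rfl⟩
  · change Function.Exact (BalancedTensor.map N (K.d (n + 1 + 1) (n + 1)).hom)
      (BalancedTensor.map N (K.d (n + 1) n).hom)
    rw [hd, hd]
    intro x
    rw [← BalancedTensor.map_map, map_eq_zero_iff _ (hT n N hN)]
    refine (BalancedTensor.map_exact N _ _ (hp (n + 1)) (hex (n + 1)) x).trans ⟨?_, ?_⟩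
    · rintro ⟨y, rfl⟩
      obtain ⟨w, rfl⟩ := BalancedTensor.map_surjective N _ (hp (n + 1 + 1)) y
      exact ⟨w, (BalancedTensor.map_map N _ _ _).symm⟩
    · rintro ⟨y, rfl⟩
      exact ⟨_, BalancedTensor.map_map N _ _ _⟩
  · have hcyc : ∀ n m, m + 1 = n →
        Nonempty ((z (n + 1)).1 ≃ₗ[R] LinearMap.ker (K.d n m).hom) := by
      rintro _ m rfl
      have hr : LinearMap.range (i (m + 1)) = LinearMap.ker (K.d (m + 1) m).hom := by
        refine Submodule.ext fun x => ?_
        rw [LinearMap.mem_ker, hker]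
        exact (hex (m + 1) x).symm
      exact ⟨(LinearEquiv.ofInjective (i (m + 1)) (hi (m + 1))).trans (LinearEquiv.ofEq _ _ hr)⟩
    obtain ⟨e⟩ := hcyc 0 (-1) rfl
    obtain ⟨e'⟩ := nonempty_cycles_iso K (i := 0) (j := -1) rfl
    rw [zero_add, hz1] at e
    exact ⟨e.toModuleIso ≪≫ e'.symm⟩

theorem nonempty_cycles_linearEquiv {P : ChainComplex (ModuleCat.{u} R) ℤ} {i j : ℤ}
    (hij : j + 1 = i) {M : ModuleCat.{u} R} (h : Nonempty (M ≅ P.cycles i)) :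
    Nonempty (M ≃ₗ[R] LinearMap.ker (P.d i j).hom) := by
  obtain ⟨e⟩ := h
  obtain ⟨e'⟩ := nonempty_cycles_iso P hij
  exact ⟨(e ≪≫ e').toLinearEquiv⟩

theorem nonempty_iso_cycles {P : ChainComplex (ModuleCat.{u} R) ℤ} {i j : ℤ} (hij : j + 1 = i) :
    Nonempty (ModuleCat.of R (LinearMap.ker (P.d i j).hom) ≅ P.cycles i) :=
  (nonempty_cycles_iso P hij).map fun e => e.symm

/-- The boundary map onto the cycles, as a surjective linear map. -/
theorem exists_boundary {P : ChainComplex (ModuleCat.{u} R) ℤ} (hP : P.Acyclic) {i j k : ℤ}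
    (hij : j + 1 = i) (hjk : k + 1 = j) : ∃ p : P.X i →ₗ[R] LinearMap.ker (P.d j k).hom,
      Function.Surjective p ∧ ∀ x, (p x : P.X j) = (P.d i j).hom x := by
  have h := exact_of_acyclic hP hij hjk
  refine ⟨(P.d i j).hom.codRestrict _ fun x => (h _).2 ⟨x, rfl⟩, fun y => ?_, fun x => rfl⟩
  obtain ⟨x, hx⟩ := (h _).1 y.2
  exact ⟨x, Subtype.ext hx⟩

/-- For injectivity of N ⊗ Z_i → N ⊗ P_i, lift a kernel element along the surjection P_{i+1} → Z_i.
The lift is a cycle of N ⊗ P, hence a boundary, and boundaries die in N ⊗ Z_i. -/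
theorem projectiveStep_cycles {P : ChainComplex (ModuleCat.{u} R) ℤ}
    (hP : ∀ m, Projective (P.X m)) (hex : P.Acyclic) (hT : IsTensorAcyclic B P) {i j k : ℤ}
    (hij : j + 1 = i) (hjk : k + 1 = j) :
    ProjectiveStep B (LinearMap.ker (P.d i j).hom) (LinearMap.ker (P.d j k).hom) := by
  obtain ⟨p, hp, hpd⟩ := exists_boundary hex hij hjk
  refine ⟨P.X i, Submodule.subtype _, p, (IsProjective.iff_projective (P.X i)).2 (hP i),
    Subtype.val_injective, fun x => ?_, hp, fun N hN => ?_⟩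
  · rw [← Subtype.val_inj, hpd]
    exact ⟨fun h => ⟨⟨x, h⟩, rfl⟩, fun ⟨y, hy⟩ => hy ▸ y.2⟩
  · obtain ⟨q, hq, hqd⟩ := exists_boundary hex (show i + 1 = i + 1 from rfl) hij
    rw [injective_iff_map_eq_zero]
    intro x hx
    obtain ⟨y, rfl⟩ := BalancedTensor.map_surjective N q hq x
    have hqc : Submodule.subtype _ ∘ₗ q = (P.d (i + 1) i).hom := LinearMap.ext hqd
    rw [BalancedTensor.map_map, hqc] at hx
    obtain ⟨w, rfl⟩ := (tensor_exact_of_acyclic (hT N hN) (show (i + 1) + 1 = i + 1 + 1 from rfl)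
      (show i + 1 = i + 1 from rfl) y).1 hx
    have h0 : q ∘ₗ (P.d (i + 1 + 1) (i + 1)).hom = 0 := by
      refine LinearMap.ext fun v => Subtype.ext ?_
      rw [LinearMap.comp_apply, hqd]
      exact (exact_of_acyclic hex (show (i + 1) + 1 = i + 1 + 1 from rfl)
        (show i + 1 = i + 1 from rfl) _).2 ⟨v, rfl⟩
    rw [BalancedTensor.map_map, h0, BalancedTensor.map_zero_left]

section Equiv

variable {X X' Y Y' : Type u} [AddCommGroup X] [Module R X] [AddCommGroup Y] [Module R Y]
  [AddCommGroup X'] [Module R X'] [AddCommGroup Y'] [Module R Y']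

theorem TensorInjective.comp {g : Y →ₗ[R] Y'} {f : X →ₗ[R] Y} (hg : TensorInjective B g)
    (hf : TensorInjective B f) : TensorInjective B (g ∘ₗ f) := fun N hN => by
  rw [BalancedTensor.map_comp]
  exact (hg N hN).comp (hf N hN)

theorem TensorInjective.of_leftInverse {f : X →ₗ[R] Y} (g : Y →ₗ[R] X) (h : g ∘ₗ f = LinearMap.id) :
    TensorInjective B f := fun N _ => by
  refine Function.LeftInverse.injective (g := BalancedTensor.map N g) fun x => ?_
  rw [BalancedTensor.map_map, h, BalancedTensor.map_id, LinearMap.id_apply]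

theorem ProjectiveStep.congr (h : ProjectiveStep B X Y) (e : X' ≃ₗ[R] X) (e' : Y ≃ₗ[R] Y') :
    ProjectiveStep B X' Y' := by
  obtain ⟨P, i, p, hP, hi, hex, hp, hT⟩ := h
  refine ⟨P, i ∘ₗ e.toLinearMap, e'.toLinearMap ∘ₗ p, hP, hi.comp e.injective, fun x => ?_,
    e'.surjective.comp hp, hT.comp (.of_leftInverse e.symm.toLinearMap (by ext; simp))⟩
  rw [LinearMap.comp_apply, LinearEquiv.coe_coe, LinearEquiv.map_eq_zero_iff, hex x]
  constructor
  · rintro ⟨y, rfl⟩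
    exact ⟨e.symm y, by simp⟩
  · rintro ⟨y, rfl⟩
    exact ⟨e y, rfl⟩

end Equiv

/-- The cycles in all degrees of a complex as in the definition of `PGF`. -/
def CyclesPGF (B : ObjectProperty (ModuleCat.{u} Rᵐᵒᵖ)) : ObjectProperty (ModuleCat.{u} R) :=
  fun M => ∃ P : ChainComplex (ModuleCat.{u} R) ℤ,
    (∀ m : ℤ, Projective (P.X m)) ∧ P.Acyclic ∧ IsTensorAcyclic B P ∧
      ∃ n, Nonempty (M ≅ P.cycles n)

theorem isStableClass_cyclesPGF : IsStableClass B (CyclesPGF B) where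
  left := by
    rintro M ⟨P, hP, hex, hT, n, hn⟩
    obtain ⟨e⟩ := nonempty_cycles_linearEquiv (j := n - 1) (by ring) hn
    exact ⟨ModuleCat.of R (LinearMap.ker (P.d (n + 1) n).hom),
      ⟨P, hP, hex, hT, n + 1, nonempty_iso_cycles rfl⟩,
      (projectiveStep_cycles hP hex hT rfl (by ring)).congr (LinearEquiv.refl R _) e.symm⟩
  right := by
    rintro M ⟨P, hP, hex, hT, n, hn⟩
    obtain ⟨e⟩ := nonempty_cycles_linearEquiv (j := n - 1) (by ring) hn
    exact ⟨ModuleCat.of R (LinearMap.ker (P.d (n - 1) (n - 1 - 1)).hom),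
      ⟨P, hP, hex, hT, n - 1, nonempty_iso_cycles (by ring)⟩,
      (projectiveStep_cycles hP hex hT (by ring) (by ring)).congr e (LinearEquiv.refl R _)⟩

/-- Splicing can start at any member of a stable class, so the degree of the cycles is irrelevant.
-/
theorem cyclesPGF_eq : CyclesPGF B = PGF B :=
  le_antisymm isStableClass_cyclesPGF.le_PGF
    fun _ ⟨P, hP, hex, hT, h⟩ => ⟨P, hP, hex, hT, 0, h⟩

theorem isStableClass_PGF : IsStableClass B (PGF B) :=
  cyclesPGF_eq (B := B) ▸ isStableClass_cyclesPGF

theorem PGF_of_linearEquiv {M M' : ModuleCat.{u} R} (hM : PGF B M) (e : M' ≃ₗ[R] M) :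
    PGF B M' := by
  obtain ⟨P, hP, hex, hT, ⟨f⟩⟩ := hM
  exact ⟨P, hP, hex, hT, ⟨e.toModuleIso ≪≫ f⟩⟩

/-- Extensions of projective modules by modules in `PGF` split: a homomorphism to a projective
module extends along a monomorphism with cokernel in `PGF`. -/
theorem PGF.exists_extension (hB : ∀ E : ModuleCat.{u} Rᵐᵒᵖ, Injective E → B E)
    {M : ModuleCat.{u} R} (hM : PGF B M) {A F : Type u} [AddCommGroup A] [Module R A]
    [AddCommGroup F] [Module R F] [Module.Projective R F] (q : A →ₗ[R] M)
    (hq : Function.Surjective q) (f : LinearMap.ker q →ₗ[R] F) :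
    ∃ g : A →ₗ[R] F, ∀ x : LinearMap.ker q, g x = f x := by
  obtain ⟨P, hP, hex, hT, hM⟩ := hM
  obtain ⟨e⟩ := nonempty_cycles_linearEquiv (i := 0) (j := -1) rfl hM
  obtain ⟨p, hp, hpd⟩ := exists_boundary hex (show (0 : ℤ) + 1 = 1 from rfl)
    (show (-1 : ℤ) + 1 = 0 from rfl)
  have : Module.Projective R (P.X 1) := (IsProjective.iff_projective _).2 (hP 1)
  -- With this lift of P_1 → M, the module `A` is the pushout of ker q and P_1 along Z_1. Extending
  -- f to `A` means extending f c from Z_1 to P_1, which is possible because f c b is a cocycle on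
  -- P_2, hence a coboundary.
  obtain ⟨t, ht⟩ := Module.projective_lifting_property q (e.symm.toLinearMap ∘ₗ p) hq
  have hqt : ∀ x, q (t x) = e.symm (p x) := LinearMap.congr_fun ht
  have hqt0 : ∀ x, (P.d 1 0).hom x = 0 → q (t x) = 0 := fun x hx => by
    have : p x = 0 := Subtype.ext ((hpd x).trans hx)
    rw [hqt, this, map_zero]
  obtain ⟨b, hb, hbd⟩ := exists_boundary hex (show (1 : ℤ) + 1 = 2 from rfl)
    (show (0 : ℤ) + 1 = 1 from rfl)
  let c : LinearMap.ker (P.d 1 0).hom →ₗ[R] LinearMap.ker q :=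
    (t ∘ₗ Submodule.subtype _).codRestrict _ fun x => hqt0 x x.2
  obtain ⟨ψ, hψ⟩ := exists_primitive_of_complex hP (fun N hN => hT N (hB N hN))
    (show (2 : ℤ) + 1 = 3 from rfl) (show (1 : ℤ) + 1 = 2 from rfl) (f ∘ₗ c ∘ₗ b) (fun x => by
      have : b ((P.d 3 2).hom x) = 0 := Subtype.ext ((hbd _).trans
        ((exact_of_acyclic hex (show (2 : ℤ) + 1 = 3 from rfl) (show (1 : ℤ) + 1 = 2 from rfl) _).2
          ⟨x, rfl⟩))
      simp [this])
  have hψc : ∀ x : LinearMap.ker (P.d 1 0).hom, ψ x = f (c x) := fun x => by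
    obtain ⟨y, rfl⟩ := hb x
    rw [hbd, hψ]
    rfl
  obtain ⟨g, hg⟩ := exists_desc ((LinearMap.ker q).subtype.coprod t) (fun a => by
    obtain ⟨x, hx⟩ := hp (e (q a))
    refine ⟨(⟨a - t x, ?_⟩, x), by simp⟩
    rw [LinearMap.mem_ker, map_sub, hqt, hx, e.symm_apply_apply, sub_self]) (f.coprod ψ) (by
    rintro ⟨v, x⟩ hvx
    simp only [LinearMap.coprod_apply, Submodule.subtype_apply] at hvx ⊢
    have hx : (P.d 1 0).hom x = 0 := by
      rw [← hpd]
      have h1 : q (t x) = 0 := by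
        rw [eq_neg_of_add_eq_zero_right hvx, map_neg, v.2, neg_zero]
      rw [hqt, LinearEquiv.map_eq_zero_iff] at h1
      rw [h1]
      rfl
    rw [hψc ⟨x, hx⟩, ← map_add]
    have : v + c ⟨x, hx⟩ = 0 := Subtype.ext hvx
    rw [this, map_zero])
  refine ⟨g, fun x => ?_⟩
  have h := hg (x, 0)
  simpa using h

end StableClasses

/-! ### Filtered modules: horseshoe lemmas on both sides. -/

section Filtrations

/-- A well-ordered filtration of the module `M` by submodules `F j`, with a surjection from each
`F j` onto a module `X j` whose kernel is the union of the preceding submodules. -/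
structure LayeredFiltration (M : Type u) [AddCommGroup M] [Module R M] (J : Type u)
    [LinearOrder J] where
  F : J → Submodule R M
  mono : Monotone F
  exhaustive : ∀ x, x = 0 ∨ ∃ j, x ∈ F j
  X : J → ModuleCat.{u} R
  q : ∀ j, F j →ₗ[R] X j
  surjective : ∀ j, Function.Surjective (q j)
  q_eq_zero_iff : ∀ j (x : F j), q j x = 0 ↔ (x : M) = 0 ∨ ∃ i < j, (x : M) ∈ F i

/-- `M` has a well-ordered filtration with successive quotients in the class `C`. -/
def IsFilteredBy (C : ObjectProperty (ModuleCat.{u} R)) : ObjectProperty (ModuleCat.{u} R) :=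
  fun M => ∃ (J : Type u) (_ : LinearOrder J) (_ : WellFoundedLT J)
    (L : LayeredFiltration (R := R) M J), ∀ j, C (L.X j)

namespace LayeredFiltration

variable {M : Type u} [AddCommGroup M] [Module R M] {J : Type u} [LinearOrder J]
  [WellFoundedLT J] (L : LayeredFiltration (R := R) M J)

theorem exists_layer {x : M} (hx : x ≠ 0) : ∃ j, ∃ h : x ∈ L.F j, L.q j ⟨x, h⟩ ≠ 0 := by
  have hne : {j | x ∈ L.F j}.Nonempty := (L.exhaustive x).resolve_left hx
  refine ⟨wellFounded_lt.min _ hne, wellFounded_lt.min_mem _ hne, fun h => ?_⟩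
  obtain h | ⟨i, hi, hxi⟩ := (L.q_eq_zero_iff _ _).1 h
  · exact hx h
  · exact wellFounded_lt.not_lt_min {j | x ∈ L.F j} (x := i) hxi hi

/-- No filtration of `Y` is needed: it suffices that maps `e j` out of `Y`, such as the components
of a direct sum, detect the layers. -/
theorem tensorInjective {B : ObjectProperty (ModuleCat.{u} Rᵐᵒᵖ)} {Y : Type u} [AddCommGroup Y]
    [Module R Y] (f : M →ₗ[R] Y) {Q : J → Type u} [∀ j, AddCommGroup (Q j)] [∀ j, Module R (Q j)]
    (m : ∀ j, L.X j →ₗ[R] Q j) (hm : ∀ j, TensorInjective B (m j)) (e : ∀ j, Y →ₗ[R] Q j)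
    (he : ∀ j (x : L.F j), e j (f x) = m j (L.q j x)) : TensorInjective B f := fun N hN =>
  BalancedTensor.map_injective_of_filtration N L.F L.mono L.exhaustive f L.q L.surjective
    (fun j x h => (L.q_eq_zero_iff j x).1 h) m (fun j => hm j N hN) e he

end LayeredFiltration

variable {J : Type u} [LinearOrder J] {P : J → Type u} [∀ j, AddCommGroup (P j)]
  [∀ j, Module R (P j)]

/-- The elements of a direct sum with vanishing components in the degrees above `j`. -/
def directSumLE (P : J → Type u) [∀ j, AddCommGroup (P j)] [∀ j, Module R (P j)] (j : J) :
    Submodule R (DirectSum J P) where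
  carrier := {x | ∀ i, j < i → x i = 0}
  zero_mem' := fun _ _ => rfl
  add_mem' := fun {x y} hx hy i hi => by rw [DirectSum.add_apply, hx i hi, hy i hi, add_zero]
  smul_mem' := fun r x hx i hi => by
    change r • x i = 0
    rw [hx i hi, smul_zero]

theorem directSumLE_mono : Monotone (directSumLE (R := R) P) :=
  fun _ _ hij _ hx k hk => hx k (hij.trans_lt hk)

theorem lof_mem_directSumLE (j : J) (x : P j) :
    DirectSum.lof R J P j x ∈ directSumLE (R := R) P j := fun i hi => by
  rw [DirectSum.lof_eq_of]
  exact DirectSum.of_eq_of_ne _ _ _ hi.ne'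

variable (R) in
theorem exists_leading_component {x : DirectSum J P} (hx : x ≠ 0) :
    ∃ i, x i ≠ 0 ∧ x ∈ directSumLE (R := R) P i := by
  classical
  have hne : (DFinsupp.support x).Nonempty := by
    rw [Finset.nonempty_iff_ne_empty]
    exact fun h => hx (DFinsupp.support_eq_empty.1 h)
  refine ⟨(DFinsupp.support x).max' hne, (DFinsupp.mem_support_toFun x _).1 (Finset.max'_mem _ hne),
    fun i hi => ?_⟩
  by_contra h
  exact (Finset.le_max' _ i ((DFinsupp.mem_support_toFun x i).2 h)).not_gt hi

variable (R) in
theorem eq_zero_or_mem_of_lt {j : J} {x : DirectSum J P} (hx : ∀ i, j ≤ i → x i = 0) :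
    x = 0 ∨ ∃ i < j, x ∈ directSumLE (R := R) P i := by
  by_cases h : x = 0
  · exact Or.inl h
  · obtain ⟨i, hi, hxi⟩ := exists_leading_component R h
    exact Or.inr ⟨i, not_le.1 fun hji => hi (hx i hji), hxi⟩

theorem toModule_mem {M : Type u} [AddCommGroup M] [Module R M] {F : J → Submodule R M}
    (hF : Monotone F) (t : ∀ j, P j →ₗ[R] F j) {j : J} {x : DirectSum J P}
    (hx : x ∈ directSumLE (R := R) P j) :
    DirectSum.toModule R J M (fun j => (F j).subtype ∘ₗ t j) x ∈ F j := by
  classical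
  rw [← DirectSum.sum_support_of x, map_sum]
  refine Submodule.sum_mem _ fun i hi => ?_
  have hij : i ≤ j := not_lt.1 fun h => (DFinsupp.mem_support_toFun x i).1 hi (hx i h)
  change DirectSum.toModule R J M _ (DirectSum.lof R J P i (x i)) ∈ F j
  rw [DirectSum.toModule_lof]
  exact hF hij (t i (x i)).2

/-- The cover of a filtered module by a sum of covers of the layers is surjective, and its kernel
is filtered by the kernels of these covers. -/
theorem LayeredFiltration.exists_left [WellFoundedLT J] {B : ObjectProperty (ModuleCat.{u} Rᵐᵒᵖ)}
    {M : ModuleCat.{u} R} (L : LayeredFiltration (R := R) M J) (K : J → ModuleCat.{u} R)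
    (hK : ∀ j, ProjectiveStep B (K j) (L.X j)) :
    ∃ (N : ModuleCat.{u} R) (L' : LayeredFiltration (R := R) N J),
      ProjectiveStep B N M ∧ L'.X = K := by
  classical
  choose P i p hP hi hex hp hT using hK
  have ht : ∀ j, ∃ t : P j →ₗ[R] L.F j, L.q j ∘ₗ t = p j := fun j =>
    Module.projective_lifting_property (L.q j) (p j) (L.surjective j)
  choose t ht using ht
  have hqt : ∀ j x, L.q j (t j x) = p j x := fun j => LinearMap.congr_fun (ht j)
  let π : DirectSum J (fun j => P j) →ₗ[R] M :=
    DirectSum.toModule R J M fun j => (L.F j).subtype ∘ₗ t j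
  have hπ : ∀ j x, π (DirectSum.lof R J (fun j => P j) j x) = (t j x : M) := fun j x =>
    DirectSum.toModule_lof R (M := fun j => P j) j x
  have hπF : ∀ j x, x ∈ directSumLE (R := R) (fun j => P j) j → π x ∈ L.F j := fun j x hx =>
    toModule_mem L.mono t hx
  have hsub : ∀ j (x : DirectSum J (fun j => P j)), x ∈ directSumLE (R := R) (fun j => P j) j →
      ∀ k, j ≤ k → (x - DirectSum.lof R J (fun j => P j) j (x j)) k = 0 := by
    intro j x hx k hk
    rw [DirectSum.sub_apply]
    rcases hk.eq_or_lt with rfl | hk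
    · rw [DirectSum.lof_apply, sub_self]
    · rw [hx k hk, lof_mem_directSumLE (R := R) (P := fun j => P j) j (x j) k hk, sub_zero]
  -- The bound on the degrees of the preimage is what makes the layer maps of the kernel surjective
  -- below.
  have hlift : ∀ j m, m ∈ L.F j → ∃ x ∈ directSumLE (R := R) (fun j => P j) j, π x = m := by
    intro j
    induction j using WellFoundedLT.induction with
    | _ j ih =>
      intro m hm
      obtain ⟨x, hx⟩ := hp j (L.q j ⟨m, hm⟩)
      have h0 : L.q j (⟨m, hm⟩ - t j x) = 0 := by rw [map_sub, hqt, hx, sub_self]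
      obtain h | ⟨k, hk, h⟩ := (L.q_eq_zero_iff j _).1 h0
      · refine ⟨_, lof_mem_directSumLE j x, ?_⟩
        rw [hπ]
        exact (sub_eq_zero.1 h).symm
      · obtain ⟨y, hy, hym⟩ := ih k hk _ h
        refine ⟨_, Submodule.add_mem _ (lof_mem_directSumLE j x) (directSumLE_mono hk.le hy), ?_⟩
        rw [map_add, hπ, hym]
        exact add_sub_cancel _ _
  have hπs : Function.Surjective π := by
    intro m
    obtain rfl | ⟨j, hj⟩ := L.exhaustive m
    · exact ⟨0, map_zero _⟩
    · obtain ⟨x, -, hx⟩ := hlift j m hj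
      exact ⟨x, hx⟩
  let G : J → Submodule R (LinearMap.ker π) := fun j =>
    (directSumLE (R := R) (fun j => P j) j).comap (LinearMap.ker π).subtype
  -- The components of x below j map to earlier pieces, so π x = 0 forces t (x j) to be zero or in
  -- an earlier piece. Hence the component in degree j comes from K j.
  have hpz : ∀ j x, x ∈ directSumLE (R := R) (fun j => P j) j → π x = 0 → p j (x j) = 0 := by
    intro j x hx h0
    rw [← hqt, L.q_eq_zero_iff]
    have hd : (t j (x j) : M) = -π (x - DirectSum.lof R J (fun j => P j) j (x j)) := by
      rw [map_sub, h0, hπ, zero_sub, neg_neg]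
    rw [hd]
    obtain h | ⟨k, hk, h⟩ := eq_zero_or_mem_of_lt R (hsub j x hx)
    · left
      rw [h, map_zero, neg_zero]
    · exact Or.inr ⟨k, hk, Submodule.neg_mem _ (hπF k _ h)⟩
  have hq' : ∀ j, ∃ q' : G j →ₗ[R] K j, ∀ x : G j,
      i j (q' x) = ((x : LinearMap.ker π) : DirectSum J fun j => P j) j := by
    intro j
    refine exists_lift_of_injective (Z := G j) (i j) (hi j)
      (DirectSum.component R J (fun j => P j) j ∘ₗ (LinearMap.ker π).subtype ∘ₗ (G j).subtype)
      fun z => ?_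
    exact (hex j _).1 (hpz j _ z.2 z.1.2)
  choose q' hq' using hq'
  let L' : LayeredFiltration (R := R) (LinearMap.ker π) J :=
    { F := G
      mono := fun j k hjk x hx => directSumLE_mono (R := R) (P := fun j => P j) hjk hx
      exhaustive := fun x => by
        by_cases hx : (x : DirectSum J fun j => P j) = 0
        · exact Or.inl (Subtype.ext hx)
        · obtain ⟨j, -, hj⟩ := exists_leading_component R hx
          exact Or.inr ⟨j, hj⟩
      X := K
      q := q'
      surjective := fun j y => by
        -- Since t (i y) is zero or in an earlier piece, a term w in degrees below j corrects i y to
        -- an element of ker π.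
        have hy : L.q j (t j (i j y)) = 0 := by
          rw [hqt]
          exact (hex j _).2 ⟨y, rfl⟩
        obtain ⟨w, hw, hwy⟩ : ∃ w : DirectSum J (fun j => P j), (∀ k, j ≤ k → w k = 0) ∧
            π w = t j (i j y) := by
          obtain h | ⟨k, hk, h⟩ := (L.q_eq_zero_iff j _).1 hy
          · exact ⟨0, fun _ _ => rfl, by rw [map_zero, h]⟩
          · obtain ⟨w, hw, hwy⟩ := hlift k _ h
            exact ⟨w, fun l hl => hw l (hk.trans_le hl), hwy⟩
        refine ⟨⟨⟨DirectSum.lof R J (fun j => P j) j (i j y) - w, ?_⟩, fun k hk => ?_⟩, hi j ?_⟩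
        · rw [LinearMap.mem_ker, map_sub, hπ, hwy, sub_self]
        · change (DirectSum.lof R J (fun j => P j) j (i j y) - w) k = 0
          rw [DirectSum.sub_apply, hw k hk.le,
            lof_mem_directSumLE (R := R) (P := fun j => P j) j _ k hk, sub_zero]
        · rw [hq']
          change (DirectSum.lof R J (fun j => P j) j (i j y) - w) j = _
          rw [DirectSum.sub_apply, hw j le_rfl, sub_zero, DirectSum.lof_apply]
      q_eq_zero_iff := fun j x => by
        rw [← map_eq_zero_iff _ (hi j), hq']
        constructor
        · intro h
          obtain h0 | ⟨k, hk, hk'⟩ := eq_zero_or_mem_of_lt R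
              (x := ((x : LinearMap.ker π) : DirectSum J fun j => P j)) (j := j) (fun k hk => by
            rcases hk.eq_or_lt with rfl | hk
            · exact h
            · exact x.2 k hk)
          · exact Or.inl (Subtype.ext h0)
          · exact Or.inr ⟨k, hk, hk'⟩
        · rintro (h | ⟨k, hk, hk'⟩)
          · rw [h]
            rfl
          · exact hk' j hk }
  exact ⟨ModuleCat.of R (LinearMap.ker π), L', ⟨ModuleCat.of R (DirectSum J fun j => P j),
    (LinearMap.ker π).subtype, π, inferInstanceAs (Module.Projective R (DirectSum J fun j => P j)),
    Subtype.val_injective, LinearMap.exact_subtype_ker_map π, hπs,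
    L'.tensorInjective (LinearMap.ker π).subtype i hT (DirectSum.component R J fun j => P j)
      fun j x => (hq' j x).symm⟩, rfl⟩

/-- A filtered module maps to a sum of projective modules, such that the induced maps on the layers
are prescribed maps to these projective modules. -/
theorem LayeredFiltration.exists_map_directSum [WellFoundedLT J]
    {B : ObjectProperty (ModuleCat.{u} Rᵐᵒᵖ)}
    (hB : ∀ E : ModuleCat.{u} Rᵐᵒᵖ, Injective E → B E) {M : Type u} [AddCommGroup M] [Module R M]
    (L : LayeredFiltration (R := R) M J) (hL : ∀ j, PGF B (L.X j))
    [∀ j, Module.Projective R (P j)] (i : ∀ j, L.X j →ₗ[R] P j) :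
    ∃ f : M →ₗ[R] DirectSum J P, ∀ j x (h : x ∈ L.F j), f x ∈ directSumLE (R := R) P j ∧
      f x j = i j (L.q j ⟨x, h⟩) := by
  classical
  -- Partial solutions are functions on all of M, with junk values outside the pieces indexed by the
  -- lower set. The value at 0 is prescribed separately, as there may be no earlier piece containing
  -- 0.
  let A := {p : Set J × (M → DirectSum J P) // IsLowerSet p.1 ∧ p.2 0 = 0 ∧ ∀ j ∈ p.1,
    (∀ x ∈ L.F j, ∀ y ∈ L.F j, p.2 (x + y) = p.2 x + p.2 y) ∧
    (∀ (r : R), ∀ x ∈ L.F j, p.2 (r • x) = r • p.2 x) ∧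
    ∀ x (h : x ∈ L.F j), p.2 x ∈ directSumLE (R := R) P j ∧ p.2 x j = i j (L.q j ⟨x, h⟩)}
  let r : A → A → Prop := fun p p' => p.1.1 ⊆ p'.1.1 ∧
    ∀ j ∈ p.1.1, ∀ x ∈ L.F j, p.1.2 x = p'.1.2 x
  have htrans : ∀ {a b c : A}, r a b → r b c → r a c := fun hab hbc =>
    ⟨hab.1.trans hbc.1, fun j hj x hx => (hab.2 j hj x hx).trans (hbc.2 j (hab.1 hj) x hx)⟩
  obtain ⟨⟨⟨S, f⟩, hS, hf0, hf⟩, hmax⟩ := exists_maximal_of_chains_bounded (r := r) (fun c hc => by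
    let T : Set J := ⋃ p ∈ c, p.1.1
    let f : M → DirectSum J P := fun x =>
      if h : ∃ p ∈ c, ∃ j ∈ p.1.1, x ∈ L.F j then h.choose.1.2 x else 0
    have hfeq : ∀ p ∈ c, ∀ j ∈ p.1.1, ∀ x ∈ L.F j, p.1.2 x = f x := by
      intro p hp j hj x hx
      have h : ∃ p ∈ c, ∃ j ∈ p.1.1, x ∈ L.F j := ⟨p, hp, j, hj, hx⟩
      have hfx : f x = h.choose.1.2 x := dif_pos h
      rw [hfx]
      by_cases heq : p = h.choose
      · rw [← heq]
      · rcases hc hp h.choose_spec.1 heq with h1 | h1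
        · exact h1.2 j hj x hx
        · obtain ⟨k, hk, hxk⟩ := h.choose_spec.2
          exact (h1.2 k hk x hxk).symm
    refine ⟨⟨⟨T, f⟩, isLowerSet_iUnion₂ fun p _ => p.2.1, ?_, fun j hj => ?_⟩, fun p hp =>
      ⟨Set.subset_biUnion_of_mem (u := fun p : A => p.1.1) hp, hfeq p hp⟩⟩
    · by_cases h : ∃ p ∈ c, ∃ j ∈ p.1.1, (0 : M) ∈ L.F j
      · obtain ⟨p, hp, j, hj, h0⟩ := h
        exact (hfeq p hp j hj 0 h0).symm.trans p.2.2.1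
      · exact dif_neg h
    · obtain ⟨p, hp, hjp⟩ := Set.mem_iUnion₂.1 hj
      obtain ⟨h1, h2, h3⟩ := p.2.2.2 j hjp
      refine ⟨fun x hx y hy => ?_, fun a x hx => ?_, fun x hx => ?_⟩
      · dsimp only
        rw [← hfeq p hp j hjp _ (Submodule.add_mem _ hx hy), ← hfeq p hp j hjp _ hx,
          ← hfeq p hp j hjp _ hy, h1 x hx y hy]
      · dsimp only
        rw [← hfeq p hp j hjp _ (Submodule.smul_mem _ a hx), ← hfeq p hp j hjp _ hx, h2 a x hx]
      · dsimp only
        rw [← hfeq p hp j hjp _ hx]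
        exact h3 x hx) htrans
  dsimp only at hS hf0 hf
  have hSu : ∀ j, j ∈ S := by
    intro j
    induction j using WellFoundedLT.induction with
    | _ j ih =>
    by_contra hj
    have hlt : ∀ k ∈ S, k < j := fun k hk => not_le.1 fun h => hj (hS h hk)
    have hadd : ∀ x y : LinearMap.ker (L.q j), f ((x : L.F j) + (y : L.F j) : M) =
        f (x : L.F j) + f (y : L.F j) := by
      intro x y
      obtain hx | ⟨k, hk, hx⟩ := (L.q_eq_zero_iff j _).1 x.2
      · rw [hx, hf0, zero_add, zero_add]
      obtain hy | ⟨l, hl, hy⟩ := (L.q_eq_zero_iff j _).1 y.2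
      · rw [hy, hf0, add_zero, add_zero]
      rcases le_total k l with h | h
      · exact (hf l (ih l hl)).1 _ (L.mono h hx) _ hy
      · exact (hf k (ih k hk)).1 _ hx _ (L.mono h hy)
    let f₀ : LinearMap.ker (L.q j) →ₗ[R] DirectSum J P :=
      { toFun := fun x => f (x : L.F j)
        map_add' := hadd
        map_smul' := fun a x => by
          obtain hx | ⟨k, hk, hx⟩ := (L.q_eq_zero_iff j _).1 x.2
          · change f (a • ((x : L.F j) : M)) = a • f _
            rw [hx, smul_zero, hf0, smul_zero]
          · exact (hf k (ih k hk)).2.1 a _ hx }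
    -- Ext vanishing extends f from ker (q j) to F j, but possibly with components in degrees ≥ j.
    -- These are cut off by τ, which changes nothing on earlier pieces, and the prescribed map is
    -- added in degree j.
    obtain ⟨g, hg⟩ := (hL j).exists_extension hB (L.q j) (L.surjective j) f₀
    let τ : DirectSum J P →ₗ[R] DirectSum J P := DFinsupp.filterLinearMap R P (· < j)
    have hτ : ∀ (x : DirectSum J P) k, τ x k = if k < j then x k else 0 := fun x k =>
      DFinsupp.filter_apply _ _ _
    let g' : L.F j →ₗ[R] DirectSum J P := τ ∘ₗ g + DirectSum.lof R J P j ∘ₗ i j ∘ₗ L.q j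
    have hg'f : ∀ (k : J) (hk : k < j) (x : L.F j) (hx : (x : M) ∈ L.F k), g' x = f x := by
      intro k hk x hx
      have h0 : L.q j x = 0 := (L.q_eq_zero_iff j x).2 (Or.inr ⟨k, hk, hx⟩)
      refine DirectSum.ext fun l => ?_
      have h1 : g x = f x := hg ⟨x, h0⟩
      simp only [g', LinearMap.add_apply, LinearMap.comp_apply, h0, map_zero, add_zero, h1, hτ]
      split_ifs with hl
      · rfl
      · exact (((hf k (ih k hk)).2.2 _ hx).1 l (hk.trans_le (not_lt.1 hl))).symm
    let f' : M → DirectSum J P := fun x => if h : x ∈ L.F j then g' ⟨x, h⟩ else f x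
    have hf' : ∀ x (h : x ∈ L.F j), f' x = g' ⟨x, h⟩ := fun x h => dif_pos h
    have hff' : ∀ k ∈ S, ∀ x ∈ L.F k, f' x = f x := fun k hk x hx => by
      rw [hf' x (L.mono (hlt k hk).le hx)]
      exact hg'f k (hlt k hk) _ hx
    refine hj ((hmax ⟨⟨insert j S, f'⟩, ?_, ?_, ?_⟩ ⟨Set.subset_insert j S, fun k hk x hx =>
      (hff' k hk x hx).symm⟩).1 (Set.mem_insert j S))
    · rintro k l hlk (rfl | hk)
      · rcases hlk.eq_or_lt with rfl | h
        · exact Set.mem_insert _ _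
        · exact Set.mem_insert_of_mem _ (ih l h)
      · exact Set.mem_insert_of_mem _ (hS hlk hk)
    · exact (hf' 0 (Submodule.zero_mem _)).trans (map_zero g')
    · rintro k (rfl | hk)
      · refine ⟨fun x hx y hy => ?_, fun a x hx => ?_, fun x hx => ⟨fun l hl => ?_, ?_⟩⟩
        · dsimp only
          rw [hf' x hx, hf' y hy, hf' _ (Submodule.add_mem _ hx hy), ← map_add]
          rfl
        · dsimp only
          rw [hf' x hx, hf' _ (Submodule.smul_mem _ a hx), ← map_smul]
          rfl
        · dsimp only
          rw [hf' x hx]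
          change τ _ l + DirectSum.lof R J P k _ l = 0
          rw [hτ, if_neg hl.not_gt, lof_mem_directSumLE (R := R) k _ l hl, add_zero]
        · dsimp only
          rw [hf' x hx]
          change τ _ k + DirectSum.lof R J P k _ k = _
          rw [hτ, if_neg (lt_irrefl k), DirectSum.lof_apply, zero_add]
          rfl
      · obtain ⟨h1, h2, h3⟩ := hf k hk
        refine ⟨fun x hx y hy => ?_, fun a x hx => ?_, fun x hx => ?_⟩
        · dsimp only
          rw [hff' k hk _ (Submodule.add_mem _ hx hy), hff' k hk _ hx, hff' k hk _ hy, h1 x hx y hy]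
        · dsimp only
          rw [hff' k hk _ (Submodule.smul_mem _ a hx), hff' k hk _ hx, h2 a x hx]
        · dsimp only
          rw [hff' k hk _ hx]
          exact h3 x hx
  refine ⟨{ toFun := f, map_add' := fun x y => ?_, map_smul' := fun a x => ?_ },
    fun j x h => (hf j (hSu j)).2.2 x h⟩
  · obtain rfl | ⟨j, hj⟩ := L.exhaustive x
    · rw [hf0, zero_add, zero_add]
    obtain rfl | ⟨k, hk⟩ := L.exhaustive y
    · rw [hf0, add_zero, add_zero]
    rcases le_total j k with h | h
    · exact (hf k (hSu k)).1 _ (L.mono h hj) _ hk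
    · exact (hf j (hSu j)).1 _ hj _ (L.mono h hk)
  · obtain rfl | ⟨j, hj⟩ := L.exhaustive x
    · rw [smul_zero, hf0, smul_zero]
    · exact (hf j (hSu j)).2.1 a x hj

/-- Embeddings of the layers of a filtered module in projective modules assemble to an embedding of
the module, and the cokernel is filtered by the cokernels of these embeddings. -/
theorem LayeredFiltration.exists_right [WellFoundedLT J] {B : ObjectProperty (ModuleCat.{u} Rᵐᵒᵖ)}
    (hB : ∀ E : ModuleCat.{u} Rᵐᵒᵖ, Injective E → B E) {M : ModuleCat.{u} R}
    (L : LayeredFiltration (R := R) M J) (hL : ∀ j, PGF B (L.X j)) (K : J → ModuleCat.{u} R)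
    (hK : ∀ j, ProjectiveStep B (L.X j) (K j)) :
    ∃ (N : ModuleCat.{u} R) (L' : LayeredFiltration (R := R) N J),
      ProjectiveStep B M N ∧ L'.X = K := by
  classical
  choose P i p hP hi hex hp hT using hK
  obtain ⟨f, hf⟩ := L.exists_map_directSum hB hL (P := fun j => P j) i
  have hfi : ∀ m, m ≠ 0 → ∃ j, m ∈ L.F j ∧ f m j ≠ 0 := by
    intro m hm
    obtain ⟨j, hj, h⟩ := L.exists_layer hm
    refine ⟨j, hj, ?_⟩
    rw [(hf j m hj).2]
    exact fun h0 => h ((map_eq_zero_iff _ (hi j)).1 h0)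
  have hfinj : Function.Injective f := by
    rw [injective_iff_map_eq_zero]
    intro m h0
    by_contra hm
    obtain ⟨j, -, h⟩ := hfi m hm
    exact h (by rw [h0]; rfl)
  -- The map f is strict for the filtrations, so the layers of its cokernel are the cokernels of the
  -- layer maps.
  have hmem : ∀ j m, f m ∈ directSumLE (R := R) (fun j => P j) j → m ∈ L.F j := by
    intro j m hm
    by_cases h0 : m = 0
    · rw [h0]
      exact Submodule.zero_mem _
    · obtain ⟨k, hk, h⟩ := hfi m h0
      exact L.mono (not_lt.1 fun hjk => h (hm k hjk)) hk
  have hpf : ∀ j m, f m ∈ directSumLE (R := R) (fun j => P j) j → p j (f m j) = 0 := by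
    intro j m hm
    rw [(hf j m (hmem j m hm)).2]
    exact (hex j _).2 ⟨_, rfl⟩
  let G : J → Submodule R (DirectSum J (fun j => P j) ⧸ LinearMap.range f) := fun j =>
    (directSumLE (R := R) (fun j => P j) j).map (LinearMap.range f).mkQ
  have hq' : ∀ j, ∃ q' : G j →ₗ[R] K j, ∀ x : directSumLE (R := R) (fun j => P j) j,
      q' ((LinearMap.range f).mkQ.submoduleMap _ x) =
        p j ((x : DirectSum J (fun j => P j)) j) := fun j =>
    exists_desc ((LinearMap.range f).mkQ.submoduleMap (directSumLE (R := R) (fun j => P j) j))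
      (LinearMap.submoduleMap_surjective _ _)
      (p j ∘ₗ DirectSum.component R J (fun j => P j) j ∘ₗ Submodule.subtype _) fun x hx => by
        obtain ⟨m, hm⟩ : ∃ m, f m = x.1 :=
          (Submodule.Quotient.mk_eq_zero _).1 (congrArg Subtype.val hx)
        change p j ((x : DirectSum J (fun j => P j)) j) = 0
        rw [← hm]
        exact hpf j m (by rw [hm]; exact x.2)
  choose q' hq' using hq'
  let L' : LayeredFiltration (R := R) (DirectSum J (fun j => P j) ⧸ LinearMap.range f) J :=
    { F := G
      mono := fun j k hjk => Submodule.map_mono (directSumLE_mono hjk)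
      exhaustive := fun y => by
        obtain ⟨x, rfl⟩ := Submodule.Quotient.mk_surjective _ y
        by_cases hx : x = 0
        · exact Or.inl (by rw [hx]; rfl)
        · obtain ⟨j, -, hj⟩ := exists_leading_component R hx
          exact Or.inr ⟨j, x, hj, rfl⟩
      X := K
      q := q'
      surjective := fun j y => by
        obtain ⟨x, rfl⟩ := hp j y
        refine ⟨_, (hq' j ⟨_, lof_mem_directSumLE j x⟩).trans ?_⟩
        rw [DirectSum.lof_apply]
      q_eq_zero_iff := fun j y => by
        obtain ⟨x, rfl⟩ := LinearMap.submoduleMap_surjective _ _ y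
        rw [hq']
        constructor
        · intro h
          obtain ⟨z, hz⟩ := (hex j _).1 h
          obtain ⟨m, rfl⟩ := L.surjective j z
          -- Subtracting f m kills the component in degree j without changing the class, which
          -- therefore comes from lower degrees.
          have hmq : (LinearMap.range f).mkQ (x - f m) = (LinearMap.range f).mkQ x := by
            rw [map_sub, sub_eq_self]
            exact (Submodule.Quotient.mk_eq_zero _).2 ⟨m, rfl⟩
          obtain h0 | ⟨k, hk, hk'⟩ := eq_zero_or_mem_of_lt R
              (x := (x : DirectSum J fun j => P j) - f m) (j := j) (fun k hk => by
            rw [DirectSum.sub_apply]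
            rcases hk.eq_or_lt with rfl | hk
            · rw [(hf j m m.2).2, hz, sub_self]
            · rw [(hf j m m.2).1 k hk, x.2 k hk, sub_zero])
          · left
            change (LinearMap.range f).mkQ x = 0
            rw [← hmq, h0, map_zero]
          · exact Or.inr ⟨k, hk, _, hk', hmq⟩
        · have hsuff : ∀ w : DirectSum J fun j => P j, w ∈ directSumLE (R := R) (fun j => P j) j →
              w j = 0 → (LinearMap.range f).mkQ w = (LinearMap.range f).mkQ x →
              p j ((x : DirectSum J fun j => P j) j) = 0 := by
            intro w hw hwj hwx
            obtain ⟨m, hm⟩ := (Submodule.Quotient.eq _).1 hwx.symm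
            have h := hpf j m (by rw [hm]; exact Submodule.sub_mem _ x.2 hw)
            rwa [hm, DirectSum.sub_apply, hwj, sub_zero] at h
          rintro (h | ⟨k, hk, w, hw, hwx⟩)
          · exact hsuff 0 (Submodule.zero_mem _) rfl ((map_zero _).trans h.symm)
          · exact hsuff w (directSumLE_mono hk.le hw) (hw j hk) hwx }
  refine ⟨ModuleCat.of R (DirectSum J (fun j => P j) ⧸ LinearMap.range f), L',
    ⟨ModuleCat.of R (DirectSum J fun j => P j), f, (LinearMap.range f).mkQ,
      inferInstanceAs (Module.Projective R (DirectSum J fun j => P j)), hfinj, fun x => ?_,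
      Submodule.mkQ_surjective _, L.tensorInjective f i hT
        (DirectSum.component R J fun j => P j) fun j x => (hf j x x.2).2⟩, rfl⟩
  exact Submodule.Quotient.mk_eq_zero _

/-- The class `PGF` is closed under well-ordered filtrations. -/
theorem isFilteredBy_PGF_le {B : ObjectProperty (ModuleCat.{u} Rᵐᵒᵖ)}
    (hB : ∀ E : ModuleCat.{u} Rᵐᵒᵖ, Injective E → B E) : IsFilteredBy (PGF B) ≤ PGF B := by
  refine IsStableClass.le_PGF (C := IsFilteredBy (PGF B)) ⟨?_, ?_⟩
  · rintro M ⟨J, _, _, L, hL⟩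
    choose K hK hstep using fun j => isStableClass_PGF.left (L.X j) (hL j)
    obtain ⟨N, L', hN, rfl⟩ := L.exists_left K hstep
    exact ⟨N, ⟨J, _, inferInstance, L', hK⟩, hN⟩
  · rintro M ⟨J, _, _, L, hL⟩
    choose K hK hstep using fun j => isStableClass_PGF.right (L.X j) (hL j)
    obtain ⟨N, L', hN, rfl⟩ := L.exists_right hB hL K hstep
    exact ⟨N, ⟨J, _, inferInstance, L', hK⟩, hN⟩

end Filtrations

/-! ### Projectives, extensions, and kernels of epimorphisms. -/

section Closure

variable {B : ObjectProperty (ModuleCat.{u} Rᵐᵒᵖ)}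

/-- The sequences 0 → 0 → M → M → 0 and 0 → M → M → 0 → 0 make the projective modules a stable
class. -/
theorem PGF_of_projective (M : ModuleCat.{u} R) (hM : Module.Projective R M) : PGF B M := by
  refine IsStableClass.le_PGF (C := fun M => Module.Projective R M) ⟨?_, ?_⟩ M hM
  · intro M hM
    exact ⟨ModuleCat.of R PUnit.{u + 1}, inferInstanceAs (Module.Projective R PUnit.{u + 1}), M, 0, LinearMap.id,
      hM, Function.injective_of_subsingleton _, by simp [Function.Exact, eq_comm],
      Function.surjective_id, .of_leftInverse 0 (Subsingleton.elim _ _)⟩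
  · intro M hM
    exact ⟨ModuleCat.of R PUnit.{u + 1}, inferInstanceAs (Module.Projective R PUnit.{u + 1}), M, LinearMap.id, 0,
      hM, Function.injective_id, fun x => by simp,
      Function.surjective_to_subsingleton _, .of_leftInverse LinearMap.id rfl⟩

/-- Adjoining `M` to `PGF B` gives a class that is still stable. -/
theorem PGF_of_projectiveSteps {M K L : ModuleCat.{u} R} (hK : PGF B K) (hKM : ProjectiveStep B K M)
    (hL : PGF B L) (hML : ProjectiveStep B M L) : PGF B M := by
  refine IsStableClass.le_PGF (C := fun X => PGF B X ∨ X = M) ⟨?_, ?_⟩ M (Or.inr rfl)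
  · rintro X (hX | rfl)
    · obtain ⟨Y, hY, h⟩ := isStableClass_PGF.left X hX
      exact ⟨Y, Or.inl hY, h⟩
    · exact ⟨K, Or.inl hK, hKM⟩
  · rintro X (hX | rfl)
    · obtain ⟨Y, hY, h⟩ := isStableClass_PGF.right X hX
      exact ⟨Y, Or.inl hY, h⟩
    · exact ⟨L, Or.inl hL, hML⟩

variable (hB : ∀ E : ModuleCat.{u} Rᵐᵒᵖ, Injective E → B E)
include hB

/-- The two-step filtration im f ⊆ Y has layers `X` and `Z`. -/
theorem PGF_of_exact {X Y Z : ModuleCat.{u} R} (hX : PGF B X) (hZ : PGF B Z) (f : X →ₗ[R] Y)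
    (g : Y →ₗ[R] Z) (hf : Function.Injective f) (hfg : Function.Exact f g)
    (hg : Function.Surjective g) : PGF B Y := by
  have hlayer : ∀ j : ULift.{u} Bool, ∃ (A : ModuleCat.{u} R)
      (q : (if j.down then ⊤ else LinearMap.range f : Submodule R Y) →ₗ[R] A), PGF B A ∧
        Function.Surjective q ∧ ∀ x, q x = 0 ↔ (x : Y) = 0 ∨ ∃ i < j,
          (x : Y) ∈ (if i.down then ⊤ else LinearMap.range f : Submodule R Y) := by
    rintro ⟨_ | _⟩
    · refine ⟨X, (LinearEquiv.ofInjective f hf).symm.toLinearMap, hX,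
        (LinearEquiv.ofInjective f hf).symm.surjective, fun x => ?_⟩
      refine (LinearEquiv.map_eq_zero_iff _).trans ⟨fun h => Or.inl (congrArg Subtype.val h), ?_⟩
      rintro (h | ⟨⟨_ | _⟩, hi, -⟩)
      · exact Subtype.ext h
      · exact absurd hi (lt_irrefl _)
      · exact absurd hi (by decide)
    · refine ⟨Z, g ∘ₗ Submodule.subtype _, hZ, fun z => ?_, fun x => ?_⟩
      · obtain ⟨y, rfl⟩ := hg z
        exact ⟨⟨y, trivial⟩, rfl⟩
      · refine (hfg (x : Y)).trans ⟨fun h => Or.inr ⟨⟨false⟩, by decide, h⟩, ?_⟩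
        rintro (h | ⟨⟨_ | _⟩, hi, h⟩)
        · exact ⟨0, by rw [map_zero, h]⟩
        · exact h
        · exact absurd hi (lt_irrefl _)
  choose A q hA hq hq0 using hlayer
  refine isFilteredBy_PGF_le hB Y ⟨ULift.{u} Bool, inferInstance, inferInstance,
    ⟨fun j => if j.down then ⊤ else LinearMap.range f, ?_, ?_, A, q, hq, hq0⟩, hA⟩
  · rintro ⟨_ | _⟩ ⟨_ | _⟩ h
    · exact le_rfl
    · exact le_top
    · exact absurd h (by decide)
    · exact le_rfl
  · exact fun x => Or.inr ⟨⟨true⟩, trivial⟩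

-- An element killed by N ⊗ j is killed by N ⊗ g, as g factors through j, so it comes from N ⊗ A,
-- where N ⊗ (j i) is injective.
omit hB in
theorem TensorInjective.of_exact {A L P Q : Type u} [AddCommGroup A] [Module R A] [AddCommGroup L]
    [Module R L] [AddCommGroup P] [Module R P] [AddCommGroup Q] [Module R Q] {i : A →ₗ[R] L}
    {g : L →ₗ[R] P} (h : Function.Exact i g) (hg : Function.Surjective g) {j : L →ₗ[R] Q}
    (hj : TensorInjective B (j ∘ₗ i)) (e : Q →ₗ[R] P) (he : e ∘ₗ j = g) :
    TensorInjective B j := by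
  intro N hN
  rw [injective_iff_map_eq_zero]
  intro x hx
  obtain ⟨y, rfl⟩ := (BalancedTensor.map_exact N i g hg h x).1 (by
    rw [← he, ← BalancedTensor.map_map, hx, map_zero])
  rw [BalancedTensor.map_map] at hx
  rw [(map_eq_zero_iff _ (hj N hN)).1 hx, map_zero]

/-- A direct summand with projective complement of a module in `PGF` belongs to `PGF`. -/
theorem PGF_of_prod {K P Z : ModuleCat.{u} R} [Module.Projective R P] (hZ : PGF B Z)
    (e : Z ≃ₗ[R] K × P) : PGF B K := by
  have hP : PGF B P := PGF_of_projective P inferInstance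
  -- The two steps of Z give steps of K. The kernel L of Q → Z → K fits into 0 → Z' → L → P → 0, and
  -- the cokernel C of K → Z → Q₁ into 0 → P → C → Z₁ → 0, so both are in `PGF B`.
  obtain ⟨Z', hZ', Q, a, b, hQ, ha, hab, hb, hT⟩ := isStableClass_PGF.left Z hZ
  obtain ⟨Z₁, hZ₁, Q₁, a₁, b₁, hQ₁, ha₁, hab₁, hb₁, hT₁⟩ := isStableClass_PGF.right Z hZ
  have heb : Function.Surjective (e ∘ b) := e.surjective.comp hb
  let s : Q →ₗ[R] K := LinearMap.fst R K P ∘ₗ e.toLinearMap ∘ₗ b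
  let t : Q →ₗ[R] P := LinearMap.snd R K P ∘ₗ e.toLinearMap ∘ₗ b
  have hs : Function.Surjective s := Prod.fst_surjective.comp heb
  have hba : ∀ x, b (a x) = 0 := fun x => (hab _).2 ⟨x, rfl⟩
  let a' : Z' →ₗ[R] LinearMap.ker s := a.codRestrict _ fun x => by simp [s, hba]
  have hat : Function.Exact a' (t ∘ₗ (LinearMap.ker s).subtype) := by
    intro x
    constructor
    · intro hx
      have hx' : e (b x) = 0 := Prod.ext x.2 hx
      obtain ⟨y, hy⟩ := (hab _).1 ((LinearEquiv.map_eq_zero_iff e).1 hx')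
      exact ⟨y, Subtype.ext hy⟩
    · rintro ⟨y, rfl⟩
      simp [a', t, hba]
  have hts : Function.Surjective (t ∘ₗ (LinearMap.ker s).subtype) := by
    intro x
    obtain ⟨y, hy⟩ := heb (0, x)
    exact ⟨⟨y, congrArg Prod.fst hy⟩, congrArg Prod.snd hy⟩
  have hL : PGF B (ModuleCat.of R (LinearMap.ker s)) :=
    PGF_of_exact hB (Y := ModuleCat.of R (LinearMap.ker s)) hZ' hP a' _
      (fun x y h => ha (congrArg Subtype.val h)) hat hts
  let j : K →ₗ[R] Q₁ := a₁ ∘ₗ e.symm.toLinearMap ∘ₗ LinearMap.inl R K P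
  have hj : Function.Injective j := ha₁.comp (e.symm.injective.comp LinearMap.inl_injective)
  have hTj : TensorInjective B j := hT₁.comp
    (.of_leftInverse (LinearMap.fst R K P ∘ₗ e.toLinearMap) (by ext; simp))
  have hb₁a : ∀ x, b₁ (a₁ x) = 0 := fun x => (hab₁ _).2 ⟨x, rfl⟩
  let k : P →ₗ[R] Q₁ ⧸ LinearMap.range j := (LinearMap.range j).mkQ ∘ₗ a₁ ∘ₗ e.symm.toLinearMap ∘ₗ
    LinearMap.inr R K P
  let l : (Q₁ ⧸ LinearMap.range j) →ₗ[R] Z₁ := (LinearMap.range j).liftQ b₁ (by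
    rintro _ ⟨x, rfl⟩
    exact hb₁a _)
  have hM : PGF B (ModuleCat.of R (Q₁ ⧸ LinearMap.range j)) := by
    refine PGF_of_exact hB (Y := ModuleCat.of R (Q₁ ⧸ LinearMap.range j)) hP hZ₁ k l ?_ ?_ ?_
    · rw [injective_iff_map_eq_zero]
      intro x hx
      obtain ⟨y, hy⟩ := (Submodule.Quotient.mk_eq_zero _).1 hx
      have h := e.symm.injective (ha₁ hy)
      exact (congrArg Prod.snd h).symm
    · intro x
      obtain ⟨x, rfl⟩ := Submodule.Quotient.mk_surjective _ x
      constructor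
      · intro hx
        obtain ⟨z, rfl⟩ := (hab₁ x).1 hx
        obtain ⟨⟨u, v⟩, rfl⟩ := e.symm.surjective z
        refine ⟨v, (Submodule.Quotient.eq _).2 ⟨-u, ?_⟩⟩
        change a₁ (e.symm (-u, 0)) = a₁ (e.symm (0, v)) - a₁ (e.symm (u, v))
        rw [← map_sub, ← map_sub, Prod.mk_sub_mk, zero_sub, sub_self]
      · rintro ⟨y, hy⟩
        rw [← hy]
        exact hb₁a _
    · intro z
      obtain ⟨x, rfl⟩ := hb₁ z
      exact ⟨Submodule.Quotient.mk x, rfl⟩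
  refine PGF_of_projectiveSteps hL
    ⟨Q, (LinearMap.ker s).subtype, s, hQ, Subtype.val_injective, LinearMap.exact_subtype_ker_map s,
      hs, .of_exact hat hts hT t rfl⟩ hM
    ⟨Q₁, j, (LinearMap.range j).mkQ, hQ₁, hj, fun x => Submodule.Quotient.mk_eq_zero _,
      Submodule.mkQ_surjective _, hTj⟩

/-- Let P → Y be a projective step with kernel Y' in `PGF B`. It lifts to `X`, so the pullback of f
along it splits as ker f × P. The projection to `X` gives 0 → Y' → ker f × P → X → 0, and the
summand P can be removed. -/
theorem PGF_ker {X Y : ModuleCat.{u} R} (hX : PGF B X) (hY : PGF B Y) (f : X →ₗ[R] Y)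
    (hf : Function.Surjective f) : PGF B (ModuleCat.of R (LinearMap.ker f)) := by
  obtain ⟨Y', hY', P, i, p, hP, hi, hip, hp, -⟩ := isStableClass_PGF.left Y hY
  obtain ⟨h, hh⟩ := Module.projective_lifting_property f p hf
  have hfh : ∀ x, f (h x) = p x := LinearMap.congr_fun hh
  have hpi : ∀ x, p (i x) = 0 := fun x => (hip _).2 ⟨x, rfl⟩
  let a : Y' →ₗ[R] LinearMap.ker f × P :=
    ((-(h ∘ₗ i)).codRestrict (LinearMap.ker f) fun x => by simp [hfh, hpi]).prod i
  let b : LinearMap.ker f × P →ₗ[R] X := (LinearMap.ker f).subtype.coprod h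
  have hZ : PGF B (ModuleCat.of R (LinearMap.ker f × P)) := by
    refine PGF_of_exact hB (Y := ModuleCat.of R (LinearMap.ker f × P)) hY' hX a b ?_ ?_ ?_
    · exact fun x y hxy => hi (congrArg Prod.snd hxy)
    · rintro ⟨u, v⟩
      constructor
      · intro huv
        have huv' : (u : X) + h v = 0 := huv
        have hv : p v = 0 := by
          have hc := congrArg f huv'
          rwa [map_add, u.2, zero_add, hfh, map_zero] at hc
        obtain ⟨y, rfl⟩ := (hip v).1 hv
        exact ⟨y, Prod.ext (Subtype.ext (eq_neg_of_add_eq_zero_left huv').symm) rfl⟩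
      · rintro ⟨y, hy⟩
        rw [← hy]
        exact neg_add_cancel (h (i y))
    · intro x
      obtain ⟨v, hv⟩ := hp (f x)
      refine ⟨(⟨x - h v, ?_⟩, v), sub_add_cancel x (h v)⟩
      rw [LinearMap.mem_ker, map_sub, hfh, hv, sub_self]
  exact PGF_of_prod hB (K := ModuleCat.of R (LinearMap.ker f)) hZ (LinearEquiv.refl R _)

theorem isResolving_PGF : IsResolving (PGF B) where
  projective_mem M hM := PGF_of_projective M ((IsProjective.iff_projective M).2 hM)
  extension_mem S hS h₁ h₃ := by
    have := hS.mono_f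
    have := hS.epi_g
    exact PGF_of_exact hB h₁ h₃ S.f.hom S.g.hom ((ModuleCat.mono_iff_injective S.f).1 inferInstance)
      ((ShortComplex.ShortExact.moduleCat_exact_iff_function_exact S).1 hS.exact)
      ((ModuleCat.epi_iff_surjective S.g).1 inferInstance)
  kernel_mem X Y f hf hX hY :=
    PGF_of_linearEquiv (PGF_ker hB hX hY f.hom ((ModuleCat.epi_iff_surjective f).1 hf))
      (ModuleCat.kernelIsoKer f).toLinearEquiv

end Closure

/-! ### Transfinite extensions as filtered modules. -/

section Transfinite

variable {J : Type u} [LinearOrder J] [SuccOrder J] [WellFoundedLT J] (S : J ⥤ ModuleCat.{u} R)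

/-- Induction on the target: an element that dies at a limit dies at an earlier stage, and a map to
a successor ends with a monomorphism. -/
theorem map_injective_of_continuous [S.IsWellOrderContinuous]
    (hmono : ∀ α : J, ¬ IsMax α → Mono (S.map (homOfLE (Order.le_succ α)))) (k : J) :
    ∀ (j : J) (h : j ≤ k), Function.Injective (S.map (homOfLE h)).hom := by
  induction k using WellFoundedLT.induction with
  | _ k ih =>
    intro j h
    rw [injective_iff_map_eq_zero]
    intro x hx
    rcases h.eq_or_lt with rfl | hjk
    · have : homOfLE h = 𝟙 j := rfl
      rwa [this, S.map_id] at hx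
    have hmin : ¬ IsMin k := fun hk => hk.not_lt hjk
    by_cases hk : Order.IsSuccPrelimit k
    · obtain ⟨hc⟩ := Functor.IsWellOrderContinuous.nonempty_isColimit (F := S) k ⟨hmin, hk⟩
      have : Nonempty (Set.Iio k) := ⟨⟨j, hjk⟩⟩
      obtain ⟨⟨i, hi⟩, f, g, hfg⟩ := Concrete.isColimit_exists_of_rep_eq _ hc
        (i := ⟨j, hjk⟩) (j := ⟨j, hjk⟩) x 0 (hx.trans (map_zero (S.map (homOfLE h)).hom).symm)
      have hji : j ≤ i := leOfHom f
      refine (injective_iff_map_eq_zero _).1 (ih i hi j hji) x ?_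
      exact hfg.trans (map_zero (S.map (homOfLE hji)).hom)
    · obtain ⟨i, hcov⟩ := Order.not_isSuccPrelimit_iff.1 hk
      have hi : ¬ IsMax i := hcov.lt.not_isMax
      obtain rfl : Order.succ i = k := hcov.succ_eq
      have hji : j ≤ i := Order.le_of_lt_succ hjk
      refine (injective_iff_map_eq_zero _).1 (ih i (Order.lt_succ_of_not_isMax hi) j hji) x ?_
      have hm := (ModuleCat.mono_iff_injective _).1 (hmono i hi)
      refine (injective_iff_map_eq_zero _).1 hm _ ?_
      have hc : S.map (homOfLE h) = S.map (homOfLE hji) ≫ S.map (homOfLE (Order.le_succ i)) := by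
        rw [← S.map_comp]
        rfl
      rw [hc] at hx
      exact hx

/-- The pieces are the images of the S_j. By continuity the piece at a limit index is the union of
the earlier ones, so its layer is the zero module; this is what `h0` is for. -/
theorem isFilteredBy_of_isTransfiniteExtension {C : ObjectProperty (ModuleCat.{u} R)}
    (h0 : C (ModuleCat.of R PUnit.{u + 1})) {M : ModuleCat.{u} R} (hM : IsTransfiniteExtension C M) :
    IsFilteredBy C M := by
  obtain ⟨J, _, _, _, _, S, ι, ⟨hι⟩, _, hbot, hsucc⟩ := hM
  have hS := map_injective_of_continuous S fun α hα => (hsucc α hα).1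
  have hnat : ∀ {i j : J} (h : i ≤ j) (x : S.obj i),
      (ι.app j).hom ((S.map (homOfLE h)).hom x) = (ι.app i).hom x := fun h x =>
    congrArg (fun f => f.hom x) ((ι.naturality (homOfLE h)).trans (Category.comp_id _))
  have hιi : ∀ j, Function.Injective (ι.app j).hom := by
    intro j
    rw [injective_iff_map_eq_zero]
    intro x hx
    obtain ⟨k, f, g, hfg⟩ := Concrete.isColimit_exists_of_rep_eq S hι x (0 : S.obj j)
      (hx.trans (map_zero (ι.app j).hom).symm)
    exact (injective_iff_map_eq_zero _).1 (hS k j (leOfHom f)) x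
      (hfg.trans (map_zero (S.map g).hom))
  have hlayer : ∀ j, ∃ (A : ModuleCat.{u} R) (q : S.obj j →ₗ[R] A), C A ∧
      Function.Surjective q ∧
        ∀ x, q x = 0 ↔ x = 0 ∨ ∃ (i : J) (h : i < j) (y : S.obj i), (S.map (homOfLE h.le)).hom y = x := by
    intro j
    by_cases hmin : IsMin j
    · obtain rfl := hmin.eq_bot
      refine ⟨S.obj ⊥, LinearMap.id, hbot, Function.surjective_id, fun x => ⟨Or.inl, ?_⟩⟩
      rintro (h | ⟨i, hi, -⟩)
      · exact h
      · exact absurd hi not_lt_bot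
    by_cases hlim : Order.IsSuccPrelimit j
    · refine ⟨ModuleCat.of R PUnit.{u + 1}, 0, h0, Function.surjective_to_subsingleton _, fun x =>
        ⟨fun _ => Or.inr ?_, fun _ => rfl⟩⟩
      obtain ⟨hc⟩ := Functor.IsWellOrderContinuous.nonempty_isColimit (F := S) j ⟨hmin, hlim⟩
      have : Nonempty (Set.Iio j) := ⟨⟨⊥, bot_lt_iff_ne_bot.2 fun h => hmin (h ▸ isMin_bot)⟩⟩
      obtain ⟨⟨i, hi⟩, y, hy⟩ := Concrete.isColimit_exists_rep _ hc x
      exact ⟨i, hi, y, hy⟩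
    · obtain ⟨i, hcov⟩ := Order.not_isSuccPrelimit_iff.1 hlim
      have hi : ¬ IsMax i := hcov.lt.not_isMax
      obtain rfl : Order.succ i = j := hcov.succ_eq
      obtain ⟨_, hC⟩ := hsucc i hi
      have hex : Function.Exact (S.map (homOfLE (Order.le_succ i))).hom
          (cokernel.π (S.map (homOfLE (Order.le_succ i)))).hom :=
        (ShortComplex.ShortExact.moduleCat_exact_iff_function_exact _).1
          (ShortComplex.exact_cokernel (S.map (homOfLE (Order.le_succ i))))
      refine ⟨_, (cokernel.π (S.map (homOfLE (Order.le_succ i)))).hom, hC,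
        (ModuleCat.epi_iff_surjective _).1 inferInstance, fun x => (hex x).trans ⟨?_, ?_⟩⟩
      · rintro ⟨y, rfl⟩
        exact Or.inr ⟨i, Order.lt_succ_of_not_isMax hi, y, rfl⟩
      · rintro (rfl | ⟨k, hk, y, rfl⟩)
        · exact ⟨0, map_zero _⟩
        · refine ⟨(S.map (homOfLE (Order.le_of_lt_succ hk))).hom y, ?_⟩
          rw [← LinearMap.comp_apply, ← ModuleCat.hom_comp, ← S.map_comp]
          rfl
  choose A q hA hq hq0 using hlayer
  let e : ∀ j, S.obj j ≃ₗ[R] LinearMap.range (ι.app j).hom := fun j =>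
    LinearEquiv.ofInjective (ι.app j).hom (hιi j)
  refine ⟨J, inferInstance, inferInstance, ⟨fun j => LinearMap.range (ι.app j).hom, ?_, ?_, A,
    fun j => q j ∘ₗ (e j).symm.toLinearMap, fun j => (hq j).comp (e j).symm.surjective, ?_⟩, hA⟩
  · rintro i j h _ ⟨x, rfl⟩
    exact ⟨_, hnat h x⟩
  · intro x
    obtain ⟨j, y, hy⟩ := Concrete.isColimit_exists_rep S hι x
    exact Or.inr ⟨j, y, hy⟩
  · intro j x
    obtain ⟨x, rfl⟩ := (e j).surjective x
    rw [LinearMap.comp_apply, LinearEquiv.coe_coe, LinearEquiv.symm_apply_apply, hq0]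
    change _ ↔ (ι.app j).hom x = 0 ∨ ∃ i < j, (ι.app j).hom x ∈ LinearMap.range (ι.app i).hom
    refine or_congr (map_eq_zero_iff _ (hιi j)).symm ⟨?_, ?_⟩
    · rintro ⟨i, hi, y, rfl⟩
      exact ⟨i, hi, y, (hnat hi.le y).symm⟩
    · rintro ⟨i, hi, y, hy⟩
      exact ⟨i, hi, y, hιi j ((hnat hi.le y).trans hy)⟩

end Transfinite

end

end RelGorenstein

theorem theorem2p6 {R : Type u} [Ring R]
    (B : CategoryTheory.ObjectProperty (ModuleCat.{u} Rᵐᵒᵖ))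
    (hB : ∀ E : ModuleCat.{u} Rᵐᵒᵖ, CategoryTheory.Injective E → B E) :
    RelGorenstein.IsResolving (RelGorenstein.PGF (R := R) B) ∧
      RelGorenstein.IsClosedUnderTransfiniteExtensions (RelGorenstein.PGF (R := R) B) :=
  ⟨RelGorenstein.isResolving_PGF hB, fun M hM => RelGorenstein.isFilteredBy_PGF_le hB M
    (RelGorenstein.isFilteredBy_of_isTransfiniteExtension
      (RelGorenstein.PGF_of_projective _ (inferInstanceAs (Module.Projective R PUnit.{u + 1}))) hM)⟩
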